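/- Setting (discrete time). Let $K\ge 1$ sensors observe independent real-valued processes $\xi^k=(\xi^k_t)_{t\in\mathbb N}$, $\xi^k_0=0$, $1\le k\le K$, on their canonical spaces, with $\mathscr F^k_t=\sigma(\xi^k_s,\,s\le t)$ and $\mathscr F_t=\bigvee_k\mathscr F^k_t$. Let $\mathsf P_0^k,\mathsf P_\infty^k$ (change at time $0$; no change) be locally equivalent laws of $\xi^k$, and put $u^k_t=\log\frac{d\mathsf P^k_0}{d\mathsf P^k_\infty}\big|_{\mathscr F^k_t}$, $u_t=\sum_{k=1}^K u^k_t$ (so $u_0=0$). For $0\le \tau<\infty$ let $\mathsf P^k_\tau$ be the law that coincides with $\mathsf P^k_\infty$ on $\mathscr F^k_\tau$ and satisfies $\frac{d\mathsf P^k_\tau}{d\mathsf P^k_\infty}\big|_{\mathscr F^k_t}=e^{u^k_t-u^k_\tau}$ for $t\ge\tau$, and let $\mathsf P_\tau=\mathsf P^1_\tau\times\dots\times\mathsf P^K_\tau$, $0\le\tau\le\infty$, with expectation $\mathsf E_\tau$. Assume that, under both $\mathsf P^k_0$ and $\mathsf P^k_\infty$, each $\{u^k_t\}$ is a random walk with respect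 to $\{\mathscr F^k_t\}$ (the increments $u^k_{t+1}-u^k_t$ are identically distributed and independent of $\mathscr F^k_t$), and that $I^k_0=\mathsf E_0[u^k_1]$ and $I^k_\infty=-\mathsf E_\infty[u^k_1]$ are finite and positive. For $\nu\in\mathbb R$ let $\mathcal S=\inf\{t\ge 1: u_t-\min_{0\le s<t}u_s\ge\nu\}$ be the centralized CUSUM time, and for an $\{\mathscr F_t\}$-stopping time $\mathcal T$ let $$\mathcal J[\mathcal T]=\sup_{\tau\ge 0}\ \mathrm{ess\,sup}\ \mathsf E_\tau\big[(u_{\mathcal T}-u_\tau)\mathbf 1\{\mathcal T>\tau\}\,\big|\,\mathscr F_\tau\big].$$ Lemma. Suppose $\mathsf E_0[(u^k_1)^2]<\infty$ for every $1\le k\le K$. Then for every $\gamma>0$ and every threshold $\nu$ for which the false alarm constraint $\mathsf E_\infty[-u_{\mathcal S}]=\gamma$ holds, $\mathcal S$ is almost surely finite under every $\mathsf P_\tau$, $0\le\tau\le\infty$, the variables $u_{\mathcal S}$ and $(u_{\mathcal S}-u_\tau)\mathbf 1\{\mathcal S>\tau\}$ are integrable under $\mathsf P_0$ and $\mathsf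 P_\tau$ ($0\le\tau<\infty$) respectively, and $$\mathcal J[\mathcal S]=\mathsf E_0[u_{\mathcal S}]\ \ge\ \log\gamma-A\,K .$$ Here $A>0$ depends neither on $\gamma$ and $\nu$ nor on $K$, but only on a lower bound $c>0$ for the average $\frac1K\sum_k I^k_0$ and on upper bounds for the averages $\frac1K\sum_k\mathsf E_0[(u^k_1)^2]$ and $\frac1K\sum_k I^k_\infty$ over the sensors: given such bounds, one $A$ serves all $K\ge1$ and all families of $K$ sensors that satisfy them. (This is the meaning of the term $\Theta(K)$.) -/

import Mathlib

open MeasureTheory ProbabilityTheory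

noncomputable section

namespace SeqChange

/-- The observed process of one sensor on its canonical space `ℕ → ℝ`: `ξ₀ = 0`, and `ξ_{n+1}` is
the `n`-th coordinate of the path. -/
def obs (t : ℕ) (x : ℕ → ℝ) : ℝ :=
  match t with
  | 0 => 0
  | n + 1 => x n

theorem measurable_obs (t : ℕ) : Measurable (obs t) := by
  cases t with
  | zero => exact measurable_const
  | succ n => exact measurable_pi_apply n

/-- The local filtration `ℱᵏ_t = σ(ξᵏ_s, s ≤ t)`. -/
def localFiltration : Filtration ℕ (inferInstance : MeasurableSpace (ℕ → ℝ)) :=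
  Filtration.natural obs fun t => (measurable_obs t).stronglyMeasurable

/-- The pair of laws `(P₀ᵏ, P_∞ᵏ)` of the observations of one sensor, with the change at time `0`
and with no change: two locally equivalent probability measures on the canonical space. -/
structure Sensor where
  P0 : Measure (ℕ → ℝ)
  Pinf : Measure (ℕ → ℝ)
  isProb0 : IsProbabilityMeasure P0
  isProbInf : IsProbabilityMeasure Pinf
  ac0 : ∀ t, P0.trim (localFiltration.le t) ≪ Pinf.trim (localFiltration.le t)
  acInf : ∀ t, Pinf.trim (localFiltration.le t) ≪ P0.trim (localFiltration.le t)

namespace Sensor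

variable (M : Sensor)

instance : IsProbabilityMeasure M.P0 := M.isProb0

instance : IsProbabilityMeasure M.Pinf := M.isProbInf

/-- The local log-likelihood ratio `uᵏ_t = log (dP₀ᵏ / dP_∞ᵏ)` on `ℱᵏ_t`. -/
def u (t : ℕ) : (ℕ → ℝ) → ℝ :=
  llr (M.P0.trim (localFiltration.le t)) (M.Pinf.trim (localFiltration.le t))

/-- The law `P_τᵏ` with the change at time `τ ∈ [0, ∞]`. For finite `τ` it is the measure with
density `exp (-uᵏ_τ)` with respect to `P₀ᵏ`; `law_trim` and `law_trim_self` below show that this is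
the measure that agrees with `P_∞ᵏ` on `ℱᵏ_τ` and satisfies
`dP_τᵏ / dP_∞ᵏ = exp (uᵏ_t - uᵏ_τ)` on `ℱᵏ_t` for `t ≥ τ`. -/
def law : WithTop ℕ → Measure (ℕ → ℝ)
  | ⊤ => M.Pinf
  | (n : ℕ) => M.P0.withDensity fun x => ENNReal.ofReal (Real.exp (-M.u n x))

theorem measurable_u (t : ℕ) : Measurable[localFiltration t] (M.u t) :=
  measurable_llr _ _

theorem law_trim {n t : ℕ} (h : n ≤ t) :
    (M.law n).trim (localFiltration.le t) = (M.Pinf.trim (localFiltration.le t)).withDensity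
      fun x => ENNReal.ofReal (Real.exp (M.u t x - M.u n x)) := by
  have hm : Measurable[localFiltration t] (M.u n) :=
    (M.measurable_u n).mono (localFiltration.mono h) le_rfl
  have hf : Measurable[localFiltration t] fun x => ENNReal.ofReal (Real.exp (-M.u n x)) :=
    ENNReal.measurable_ofReal.comp (Real.measurable_exp.comp hm.neg)
  have h1 : (M.law n).trim (localFiltration.le t) =
      (M.P0.trim (localFiltration.le t)).withDensity
        fun x => ENNReal.ofReal (Real.exp (-M.u n x)) :=
    (trim_withDensity (localFiltration.le t) hf)
  rw [h1, ← Measure.withDensity_rnDeriv_eq _ _ (M.ac0 t),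
    ← withDensity_mul _ (Measure.measurable_rnDeriv _ _) hf]
  refine withDensity_congr_ae ?_
  filter_upwards [exp_llr_of_ac' _ _ (M.acInf t),
    Measure.rnDeriv_lt_top (M.P0.trim (localFiltration.le t))
      (M.Pinf.trim (localFiltration.le t))] with x hx hx'
  have h2 : Real.exp (M.u t x) = _ := hx
  rw [sub_eq_add_neg, Real.exp_add, ENNReal.ofReal_mul (Real.exp_nonneg _), h2,
    ENNReal.ofReal_toReal hx'.ne]
  rfl

theorem law_trim_self (n : ℕ) :
    (M.law n).trim (localFiltration.le n) = M.Pinf.trim (localFiltration.le n) := by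
  simp [M.law_trim (le_refl n)]

/-- `{uᵏ_t}` is a random walk under `μ`: each increment has the law of `uᵏ_1` and is independent of
the past `ℱᵏ_t` (note `uᵏ_0 = 0`). -/
def IsRandomWalk (μ : Measure (ℕ → ℝ)) : Prop :=
  ∀ t, Indep (MeasurableSpace.comap (fun x => M.u (t + 1) x - M.u t x) inferInstance)
      (localFiltration t) μ ∧
    IdentDistrib (fun x => M.u (t + 1) x - M.u t x) (M.u 1) μ μ

/-- The Kullback–Leibler number `I₀ᵏ = E₀[uᵏ_1]`. -/
def I0 : ℝ := ∫ x, M.u 1 x ∂M.P0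

/-- The Kullback–Leibler number `I_∞ᵏ = -E_∞[uᵏ_1]`. -/
def Iinf : ℝ := -∫ x, M.u 1 x ∂M.Pinf

/-- Standing assumptions on a sensor in discrete time: the log-likelihood ratio is a random walk
under both laws, and both Kullback–Leibler numbers are finite and positive. -/
structure Admissible : Prop where
  walk0 : M.IsRandomWalk M.P0
  walkInf : M.IsRandomWalk M.Pinf
  int0 : Integrable (M.u 1) M.P0
  intInf : Integrable (M.u 1) M.Pinf
  I0_pos : 0 < M.I0
  Iinf_pos : 0 < M.Iinf

end Sensor

/-- The canonical space of the `K`-dimensional observation process. -/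
abbrev Path (K : ℕ) : Type := Fin K → ℕ → ℝ

/-- The global filtration `ℱ_t = ⋁_k ℱᵏ_t`. -/
def globalFiltration (K : ℕ) : Filtration ℕ (inferInstance : MeasurableSpace (Path K)) where
  seq t := ⨆ k : Fin K, (localFiltration t).comap fun ω : Path K => ω k
  mono' _ _ h := iSup_mono fun _ => MeasurableSpace.comap_mono (localFiltration.mono h)
  le' t := iSup_le fun k =>
    (MeasurableSpace.comap_mono (localFiltration.le t)).trans (measurable_pi_apply k).comap_le

section Network

variable {K : ℕ} (M : Fin K → Sensor)

/-- The law `P_τ = P_τ¹ × ⋯ × P_τᴷ` of the observations of all sensors, with the change at time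
`τ ∈ [0, ∞]`. -/
def law (τ : WithTop ℕ) : Measure (Path K) := Measure.pi fun k => (M k).law τ

/-- The global log-likelihood ratio `u_t = u¹_t + ⋯ + uᴷ_t`. -/
def u (t : ℕ) (ω : Path K) : ℝ := ∑ k, (M k).u t (ω k)

/-- The centralized CUSUM statistic `y_t = u_t - inf_{0 ≤ s < t} u_s`, for `t ≥ 1`. -/
def y (t : ℕ) (ω : Path K) : ℝ := u M t ω - ⨅ s : Fin t, u M s ω

/-- The centralized CUSUM time `inf {t : y_t ≥ ν}`. At `t = 0` the infimum in `y` is over the empty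
set, hence `+∞`, so that `y_0 = -∞` is below every real threshold and the search starts at `t = 1`.
(For `ν > 0`, the convention `y_0 = 0` gives the same time.) -/
def cusum (ν : ℝ) : Path K → WithTop ℕ := hittingAfter (y M) (Set.Ici ν) 1

/-- The conditional Kullback–Leibler delay `(u_T - u_τ) 1{T > τ}` of a random time `T`, for a change
at `τ`. -/
def klDelay (T : Path K → WithTop ℕ) (τ : ℕ) : Path K → ℝ :=
  Set.indicator {ω | (τ : WithTop ℕ) < T ω} fun ω => stoppedValue (u M) T ω - u M τ ω

/-- The performance measure
`J[T] = sup_{τ ≥ 0} ess sup E_τ[(u_T - u_τ) 1{T > τ} | ℱ_τ]`, as an extended real. -/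
def J (T : Path K → WithTop ℕ) : EReal :=
  ⨆ τ : ℕ, essSup
    (fun ω => (((law M τ)[klDelay M T τ | globalFiltration K τ] ω : ℝ) : EReal)) (law M τ)

end Network

end SeqChange

end

/-!
Write `P` for the law without change, `Q` for the law with a change at time `0`, and `S` for the
CUSUM time, so that `S > n` means that `u` has not risen by `ν` or more between two times up to `n`
(`noAlarm`, `lt_cusum_iff`). Under the law with a change at `τ`, the process `u` is from time `τ` on a
random walk with respect to the global filtration (`isWalkFrom_law`), and on `ℱ_t` the density of `Q`
with respect to `P` is `exp u_t` (`law_zero_apply`).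

*The performance measure.* Wald's identity (`IsWalkFrom.wald`) turns integrals of the delay over an
event `A` of `ℱ_τ` into sums of the probabilities of `A ∩ {S > τ + i}`. The CUSUM procedure restarted
at `τ` forgets the earlier path, so its alarm is no earlier than `S`; it is independent of `ℱ_τ`, and
has the law of `S` under `Q`. Hence the conditional delay is at most `E_Q u_S`
(`measure_inter_noAlarm_le`), with equality at `τ = 0`, where `ℱ_0` is trivial.

*The lower bound.* By Wald's identity `γ = I_∞ E_P S`, so that what is needed is a bound on `E_P S` by
a constant times `exp (E_Q u_S)`. Let `ρ = E_Q exp (-u_1 / 2) < 1` be the Hellinger affinity of one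
step. The record lows of `u` split the time before `S` into cycles.
* Under `P`, the length of a cycle has expectation at most
  `1 + ∑_{j ≥ 1} P(u_j > 0) ≤ ∑ ρ ^ j = (1 - ρ)⁻¹` (`tsum_noAlarm_le`,
  `tsum_posPath_le`).
* If `β` is the `P`-probability that a fresh cycle ends in an alarm, the expected number of cycles is
  at most `β⁻¹`, as at most one of them ends in an alarm (`tsum_cycles_mul_le_one`).
* A change of measure gives `β = E_Q [exp (-u_N); upward exit]`, with `N` the time of exit
  (`walkLaw_upExit`). At the time `S`, the path restarted at the last minimum makes an upward exit, so
  summing over the record lows gives `E_Q exp (-(u_S - min u)) ≤ β ∑ Q(u_s ≤ 0) ≤ β (1 - ρ)⁻¹`.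
* By Jensen's inequality, and as `E_Q (-min u) ≤ ∑ E_Q (u_s)⁻ ≤ (1 - ρ)⁻¹`, this yields
  `E_P S ≤ (1 - ρ)⁻² exp (E_Q u_S + (1 - ρ)⁻¹)` (`tsum_noAlarm_le_exp`).

No bound on the overshoot is needed, since `u_S` appears on both sides. Finally
`2 (1 - ρ) = E_Q (1 - exp (-u_1 / 2))²`. Under `Q` the mean of `u_1` is at least `c K` and its second
moment at most `V K ^ 2`, so that `u_1` exceeds a fixed positive level with a probability bounded
below uniformly in `K`. This bounds `(1 - ρ)⁻¹` by a constant (`inv_one_sub_affinity_le`), and `K`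
enters the bound only through `log I_∞ ≤ log (W K)`.
-/

noncomputable section

namespace SeqChange

open Set Filter
open scoped ENNReal

section Walk

variable {Ω : Type*} {mΩ : MeasurableSpace Ω}

/-! ### Random walks with respect to a filtration -/

/-- Under `P`, the process `u` starts at `0`, is adapted to `F`, and from time `τ` on it is a random
walk with respect to `F` whose steps have law `μ`. -/
structure IsWalkFrom (P : Measure Ω) (F : Filtration ℕ mΩ) (u : ℕ → Ω → ℝ) (τ : ℕ)
    (μ : Measure ℝ) : Prop where
  zero : ∀ ω, u 0 ω = 0
  adapted : ∀ t, Measurable[F t] (u t)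
  indep : ∀ t, τ ≤ t →
    Indep (MeasurableSpace.comap (fun ω => u (t + 1) ω - u t ω) inferInstance) (F t) P
  map_step : ∀ t, τ ≤ t → P.map (fun ω => u (t + 1) ω - u t ω) = μ

/-- The path of the process `u` after time `s`, started afresh at `0`. -/
def pathFrom (u : ℕ → Ω → ℝ) (s : ℕ) (ω : Ω) : ℕ → ℝ := fun i => u (s + i) ω - u s ω

/-- The law on `ℕ → ℝ` of a random walk started at `0` whose steps have law `μ`. -/
def walkLaw (μ : Measure ℝ) : Measure (ℕ → ℝ) :=
  (Measure.infinitePi fun _ : ℕ => μ).map fun x n => ∑ i ∈ Finset.range n, x i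

namespace IsWalkFrom

variable {P : Measure Ω} {F : Filtration ℕ mΩ} {u : ℕ → Ω → ℝ} {τ : ℕ} {μ : Measure ℝ}

theorem mono (h : IsWalkFrom P F u τ μ) {s : ℕ} (hs : τ ≤ s) : IsWalkFrom P F u s μ :=
  ⟨h.zero, h.adapted, fun t ht => h.indep t (hs.trans ht), fun t ht => h.map_step t (hs.trans ht)⟩

theorem measurable (h : IsWalkFrom P F u τ μ) (t : ℕ) : Measurable (u t) :=
  (h.adapted t).mono (F.le t) le_rfl

theorem measurable_filtration (h : IsWalkFrom P F u τ μ) {s t : ℕ} (hst : s ≤ t) :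
    Measurable[F t] (u s) :=
  (h.adapted s).mono (F.mono hst) le_rfl

theorem measurable_step (h : IsWalkFrom P F u τ μ) (t : ℕ) :
    Measurable fun ω => u (t + 1) ω - u t ω :=
  (h.measurable _).sub (h.measurable _)

theorem measurable_pathFrom (h : IsWalkFrom P F u τ μ) (s : ℕ) : Measurable (pathFrom u s) :=
  measurable_pi_lambda _ fun i => (h.measurable (s + i)).sub (h.measurable s)

theorem pathFrom_zero (h : IsWalkFrom P F u τ μ) (ω : Ω) : pathFrom u 0 ω = fun i => u i ω := by
  funext i
  simp [pathFrom, h.zero]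

theorem isProbabilityMeasure_step [IsProbabilityMeasure P] (h : IsWalkFrom P F u τ μ) :
    IsProbabilityMeasure μ := by
  rw [← h.map_step τ le_rfl]
  exact Measure.isProbabilityMeasure_map (h.measurable_step τ).aemeasurable

theorem measure_inter_steps (h : IsWalkFrom P F u τ μ) {A : Set Ω} (hA : MeasurableSet[F τ] A)
    {b : ℕ → Set ℝ} (hb : ∀ i, MeasurableSet (b i)) (n : ℕ) :
    MeasurableSet[F (τ + n)] (A ∩ {ω | ∀ i < n, u (τ + i + 1) ω - u (τ + i) ω ∈ b i}) ∧
    P (A ∩ {ω | ∀ i < n, u (τ + i + 1) ω - u (τ + i) ω ∈ b i}) =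
      P A * ∏ i ∈ Finset.range n, μ (b i) := by
  induction n with
  | zero => simpa using hA
  | succ n ih =>
    have hs : A ∩ {ω | ∀ i < n + 1, u (τ + i + 1) ω - u (τ + i) ω ∈ b i} =
        (fun ω => u (τ + n + 1) ω - u (τ + n) ω) ⁻¹' b n ∩
          (A ∩ {ω | ∀ i < n, u (τ + i + 1) ω - u (τ + i) ω ∈ b i}) := by
      ext ω
      simp only [mem_inter_iff, mem_ofPred_eq, Nat.lt_succ_iff_lt_or_eq, mem_preimage]
      constructor
      · rintro ⟨h1, h2⟩
        exact ⟨h2 n (Or.inr rfl), h1, fun i hi => h2 i (Or.inl hi)⟩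
      · rintro ⟨h1, h2, h3⟩
        refine ⟨h2, fun i hi => ?_⟩
        rcases hi with hi | rfl
        exacts [h3 i hi, h1]
    rw [hs]
    constructor
    · refine MeasurableSet.inter ?_ (F.mono (Nat.le_succ _) _ ih.1)
      exact (((h.adapted (τ + n + 1)).sub (h.measurable_filtration (Nat.le_succ _))) (hb n))
    · rw [(Indep_iff _ _ P).1 (h.indep (τ + n) (Nat.le_add_right _ _)) _ _ ⟨b n, hb n, rfl⟩ ih.1,
        ih.2, ← Measure.map_apply (h.measurable_step _) (hb n),
        h.map_step (τ + n) (Nat.le_add_right _ _), Finset.prod_range_succ]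
      ring

/-- The restarted path after time `τ` is independent of the past and is a random walk with steps of
law `μ`. -/
theorem map_restrict_pathFrom [IsProbabilityMeasure P] (h : IsWalkFrom P F u τ μ) {A : Set Ω}
    (hA : MeasurableSet[F τ] A) : (P.restrict A).map (pathFrom u τ) = P A • walkLaw μ := by
  have := h.isProbabilityMeasure_step
  by_cases h0 : P A = 0
  · simp [Measure.restrict_eq_zero.2 h0, h0]
  let X : Ω → ℕ → ℝ := fun ω i => u (τ + i + 1) ω - u (τ + i) ω
  have hX : Measurable X := measurable_pi_lambda _ fun i => h.measurable_step (τ + i)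
  have hsum : Measurable fun (x : ℕ → ℝ) (n : ℕ) => ∑ i ∈ Finset.range n, x i :=
    measurable_pi_lambda _ fun n => Finset.measurable_sum _ fun i _ => measurable_pi_apply i
  have hpath : pathFrom u τ = (fun (x : ℕ → ℝ) (n : ℕ) => ∑ i ∈ Finset.range n, x i) ∘ X := by
    funext ω n
    exact (Finset.sum_range_sub (fun i => u (τ + i) ω) n).symm
  have key : (P A)⁻¹ • (P.restrict A).map X = Measure.infinitePi fun _ : ℕ => μ := by
    refine Measure.eq_infinitePi _ fun I b hb => ?_
    classical
    obtain ⟨n, hn⟩ := I.exists_nat_subset_range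
    let b' : ℕ → Set ℝ := fun i => if i ∈ I then b i else univ
    have hb' : ∀ i, MeasurableSet (b' i) := fun i => by
      dsimp only [b']; split_ifs; exacts [hb i, MeasurableSet.univ]
    have hpre : X ⁻¹' (I : Set ℕ).pi b ∩ A =
        A ∩ {ω | ∀ i < n, u (τ + i + 1) ω - u (τ + i) ω ∈ b' i} := by
      ext ω
      simp only [mem_inter_iff, mem_preimage, Set.mem_pi, mem_ofPred_eq, Finset.mem_coe, b', X]
      constructor
      · rintro ⟨h1, h2⟩
        refine ⟨h2, fun i _ => ?_⟩
        split_ifs with hi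
        exacts [h1 i hi, mem_univ _]
      · rintro ⟨h1, h2⟩
        refine ⟨fun i hi => ?_, h1⟩
        simpa [hi] using h2 i (Finset.mem_range.1 (hn hi))
    have hprod : ∏ i ∈ Finset.range n, μ (b' i) = ∏ i ∈ I, μ (b i) := by
      rw [← Finset.prod_subset hn (f := fun i => μ (b' i))]
      · exact Finset.prod_congr rfl fun i hi => by simp [b', hi]
      · intro i _ hi
        simp [b', hi]
    have hm : MeasurableSet ((I : Set ℕ).pi b) :=
      MeasurableSet.pi I.countable_toSet fun i _ => hb i
    rw [Measure.smul_apply, Measure.map_apply hX hm, Measure.restrict_apply (hX hm), hpre,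
      (h.measure_inter_steps hA hb' n).2, hprod, smul_eq_mul, ← mul_assoc,
      ENNReal.inv_mul_cancel h0 (measure_ne_top P A), one_mul]
  rw [walkLaw, ← key, Measure.map_smul, Measure.map_map hsum hX, ← hpath, smul_smul,
    ENNReal.mul_inv_cancel h0 (measure_ne_top P A), one_smul]

theorem map_path [IsProbabilityMeasure P] (h : IsWalkFrom P F u 0 μ) :
    P.map (fun ω i => u i ω) = walkLaw μ := by
  have := h.map_restrict_pathFrom MeasurableSet.univ
  rwa [Measure.restrict_univ, measure_univ, one_smul, funext h.pathFrom_zero] at this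

theorem measure_inter_pathFrom [IsProbabilityMeasure P] (h : IsWalkFrom P F u τ μ) {A : Set Ω}
    (hA : MeasurableSet[F τ] A) {B : Set (ℕ → ℝ)} (hB : MeasurableSet B) :
    P (A ∩ pathFrom u τ ⁻¹' B) = P A * walkLaw μ B := by
  have := congrArg (fun m => m B) (h.map_restrict_pathFrom hA)
  simpa [Measure.map_apply (h.measurable_pathFrom τ) hB,
    Measure.restrict_apply (h.measurable_pathFrom τ hB), inter_comm] using this

theorem setLIntegral_pathFrom [IsProbabilityMeasure P] (h : IsWalkFrom P F u τ μ) {A : Set Ω}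
    (hA : MeasurableSet[F τ] A) {g : (ℕ → ℝ) → ℝ≥0∞} (hg : Measurable g) :
    ∫⁻ ω in A, g (pathFrom u τ ω) ∂P = P A * ∫⁻ v, g v ∂walkLaw μ := by
  rw [← lintegral_map hg (h.measurable_pathFrom τ), h.map_restrict_pathFrom hA,
    lintegral_smul_measure, smul_eq_mul]

/-! ### Wald's identity -/

/-- **Wald's identity**, localized to an event `A` of the past: the steps of the walk are added up
as long as the events `E i` occur, each of which is decided before the `i`-th step. -/
theorem wald [IsProbabilityMeasure P] (h : IsWalkFrom P F u τ μ) (hμ : Integrable id μ)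
    {E : ℕ → Set Ω} (hE : ∀ i, MeasurableSet[F (τ + i)] (E i)) (hsum : ∑' i, P (E i) ≠ ∞)
    {D : Ω → ℝ} (hD : ∀ᵐ ω ∂P, D ω =
      ∑' i, (E i).indicator (fun ω => u (τ + i + 1) ω - u (τ + i) ω) ω) :
    Integrable D P ∧ ∀ A, MeasurableSet[F τ] A →
      ∫ ω in A, D ω ∂P = (∫ x, x ∂μ) * (∑' i, P (A ∩ E i)).toReal := by
  let X : ℕ → Ω → ℝ := fun i ω => u (τ + i + 1) ω - u (τ + i) ω
  have hX : ∀ i, Measurable (X i) := fun i => h.measurable_step _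
  have hmap : ∀ i, P.map (X i) = μ := fun i => h.map_step _ (Nat.le_add_right _ _)
  have hE' : ∀ i, MeasurableSet (E i) := fun i => F.le _ _ (hE i)
  have hindep : ∀ i, ∀ B, MeasurableSet[F (τ + i)] B → ∀ g : ℝ → ℝ≥0∞, Measurable g →
      ∫⁻ ω in B, g (X i ω) ∂P = P B * ∫⁻ x, g x ∂μ := by
    intro i B hB g hg
    have hB' := F.le _ _ hB
    have := lintegral_mul_eq_lintegral_mul_lintegral_of_independent_measurableSpace
      (f := fun ω => g (X i ω)) (g := B.indicator fun _ => (1 : ℝ≥0∞))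
      ((hX i).comap_le) (F.le (τ + i)) (h.indep (τ + i) (Nat.le_add_right _ _))
      (hg.comp (comap_measurable _)) (Measurable.indicator (m := F (τ + i)) measurable_const hB)
    rw [lintegral_indicator_const hB', one_mul] at this
    rw [← hmap i, lintegral_map hg (hX i), mul_comm, ← this,
      ← lintegral_indicator hB']
    refine lintegral_congr fun ω => ?_
    by_cases hω : ω ∈ B <;> simp [hω]
  have hint : ∀ i, ∀ B, MeasurableSet[F (τ + i)] B →
      ∫ ω in B, X i ω ∂P = (∫ x, x ∂μ) * (P B).toReal := by
    intro i B hB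
    have hmB : (P.restrict B).map (X i) = P B • μ := by
      ext s hs
      rw [Measure.map_apply (hX i) hs, ← lintegral_indicator_one (hX i hs)]
      have := hindep i B hB (s.indicator 1) (measurable_one.indicator hs)
      rw [lintegral_indicator_one hs] at this
      rw [Measure.smul_apply, smul_eq_mul, ← this]
      rfl
    have := integral_map (μ := P.restrict B) (φ := X i) (f := id) (hX i).aemeasurable
      measurable_id.aestronglyMeasurable
    rw [hmB, integral_smul_measure] at this
    simp only [id] at this
    rw [← this, smul_eq_mul, mul_comm]
  have hfin : ∑' i, ∫⁻ ω, ‖(E i).indicator (X i) ω‖ₑ ∂P ≠ ∞ := by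
    have : ∀ i, ∫⁻ ω, ‖(E i).indicator (X i) ω‖ₑ ∂P = P (E i) * ∫⁻ x, ‖x‖ₑ ∂μ := by
      intro i
      rw [← hindep i (E i) (hE i) (fun x => ‖x‖ₑ) measurable_enorm, ← lintegral_indicator (hE' i)]
      refine lintegral_congr fun ω => ?_
      by_cases hω : ω ∈ E i <;> simp [hω]
    simp_rw [this]
    rw [ENNReal.tsum_mul_right]
    exact ENNReal.mul_ne_top hsum hμ.2.ne
  have hmeas : ∀ i, AEStronglyMeasurable ((E i).indicator (X i)) P := fun i =>
    ((hX i).indicator (hE' i)).aestronglyMeasurable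
  constructor
  · have hDm : AEStronglyMeasurable D P := by
      refine AEStronglyMeasurable.congr ?_ (hD.mono fun ω hω => hω.symm)
      exact (Measurable.tsum fun i => (hX i).indicator (hE' i)).aestronglyMeasurable
    refine ⟨hDm, ?_⟩
    rw [hasFiniteIntegral_iff_enorm]
    refine lt_of_le_of_lt ?_ hfin.lt_top
    rw [← lintegral_tsum fun i => (hmeas i).enorm]
    refine lintegral_mono_ae (hD.mono fun ω hω => ?_)
    rw [hω]
    exact enorm_tsum_le_tsum_enorm
  · intro A hA
    have hA' := F.le _ _ hA
    have hfinA : ∑' i, ∫⁻ ω, ‖(E i).indicator (X i) ω‖ₑ ∂P.restrict A ≠ ∞ :=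
      ne_top_of_le_ne_top hfin (ENNReal.tsum_le_tsum fun i =>
        lintegral_mono' Measure.restrict_le_self le_rfl)
    rw [integral_congr_ae (ae_restrict_of_ae hD),
      integral_tsum (fun i => (hmeas i).restrict) hfinA]
    have hAE : ∀ i, ∫ ω in A, (E i).indicator (X i) ω ∂P =
        (∫ x, x ∂μ) * (P (A ∩ E i)).toReal := by
      intro i
      rw [setIntegral_indicator (hE' i)]
      exact hint i _ ((F.mono (Nat.le_add_right _ _) _ hA).inter (hE i))
    simp_rw [hAE]
    rw [tsum_mul_left, ENNReal.tsum_toReal_eq fun i => measure_ne_top P _]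

end IsWalkFrom

/-! ### Record lows, cycles and alarms -/

/-- The event that by time `n` the process `u` has not risen by `ν` or more between two times. It is
the event that the CUSUM time with threshold `ν` exceeds `n`. -/
def noAlarm (u : ℕ → Ω → ℝ) (ν : ℝ) (n : ℕ) : Set Ω :=
  {ω | ∀ t ≤ n, ∀ s < t, u t ω - u s ω < ν}

/-- The event that `s` is a weak record low of `u`. -/
def recordLow (u : ℕ → Ω → ℝ) (s : ℕ) : Set Ω := {ω | ∀ r < s, u s ω ≤ u r ω}

/-- The paths that are positive at the times `1, …, j`. -/
def posPath (j : ℕ) : Set (ℕ → ℝ) := {v | ∀ i ≤ j, 1 ≤ i → 0 < v i}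

/-- The paths that stay in `(0, ν)` at the times `1, …, n - 1` and are at least `ν` at time
`n`. -/
def upExit (ν : ℝ) (n : ℕ) : Set (ℕ → ℝ) :=
  {v | 1 ≤ n ∧ ν ≤ v n ∧ ∀ i < n, 1 ≤ i → 0 < v i ∧ v i < ν}

theorem measurableSet_posPath (j : ℕ) : MeasurableSet (posPath j) := by
  unfold posPath; measurability

theorem measurableSet_upExit (ν : ℝ) (n : ℕ) : MeasurableSet (upExit ν n) := by
  unfold upExit; measurability

theorem pairwise_disjoint_upExit (ν : ℝ) : Pairwise (Function.onFun Disjoint (upExit ν)) := by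
  refine (pairwise_disjoint_on _).2 fun m n hmn => Set.disjoint_left.2 fun v hm hn => ?_
  exact absurd (hn.2.2 m hmn hm.1).2 (not_lt.2 hm.2.1)

theorem noAlarm_zero (u : ℕ → Ω → ℝ) (ν : ℝ) : noAlarm u ν 0 = univ := by
  ext ω
  simp [noAlarm]

theorem noAlarm_anti (u : ℕ → Ω → ℝ) (ν : ℝ) : Antitone (noAlarm u ν) :=
  fun _ _ hmn _ hω t ht s hs => hω t (ht.trans hmn) s hs

/-- The last minimizer of `u` over the times `0, …, n`. -/
theorem exists_last_min (u : ℕ → ℝ) (n : ℕ) :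
    ∃ s ≤ n, (∀ r ≤ n, u s ≤ u r) ∧ ∀ r ≤ n, s < r → u s < u r := by
  induction n with
  | zero => exact ⟨0, le_rfl, fun r hr => by simp [Nat.le_zero.1 hr], fun r hr h => by omega⟩
  | succ n ih =>
    obtain ⟨s, hs, h1, h2⟩ := ih
    rcases le_or_gt (u (n + 1)) (u s) with h | h
    · refine ⟨n + 1, le_rfl, fun r hr => ?_, fun r hr h => by omega⟩
      rcases Nat.le_succ_iff.1 hr with hr | rfl
      exacts [h.trans (h1 r hr), le_rfl]
    · refine ⟨s, hs.trans n.le_succ, fun r hr => ?_, fun r hr hsr => ?_⟩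
      · rcases Nat.le_succ_iff.1 hr with hr | rfl
        exacts [h1 r hr, h.le]
      · rcases Nat.le_succ_iff.1 hr with hr | rfl
        exacts [h2 r hr hsr, h]

/-- Without an alarm by time `n`, the last minimum before `n` is a record low after which the path
stays positive. -/
theorem noAlarm_subset (u : ℕ → Ω → ℝ) (ν : ℝ) (n : ℕ) :
    noAlarm u ν n ⊆ ⋃ s, if s ≤ n then
      noAlarm u ν s ∩ recordLow u s ∩ pathFrom u s ⁻¹' posPath (n - s) else ∅ := by
  intro ω hω
  obtain ⟨s, hs, h1, h2⟩ := exists_last_min (fun i => u i ω) n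
  refine mem_iUnion.2 ⟨s, ?_⟩
  rw [if_pos hs]
  refine ⟨⟨noAlarm_anti u ν hs hω, fun r hr => h1 r (hr.le.trans hs)⟩, fun i hi hi' => ?_⟩
  exact sub_pos.2 (h2 (s + i) (by omega) (by omega))

/-- A cycle that begins at a record low and ends in an alarm is the last one. -/
theorem pairwise_disjoint_cycles (u : ℕ → Ω → ℝ) (ν : ℝ) :
    Pairwise (Function.onFun Disjoint fun s =>
      noAlarm u ν s ∩ recordLow u s ∩ pathFrom u s ⁻¹' ⋃ n, upExit ν n) := by
  refine (pairwise_disjoint_on _).2 fun s s' hs => Set.disjoint_left.2 fun ω h h' => ?_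
  obtain ⟨n, hn, hν, hi⟩ := mem_iUnion.1 h.2
  obtain ⟨⟨hA, hR⟩, -⟩ := h'
  have hlt : s' < s + n := by
    by_contra hle
    exact absurd (hA (s + n) (not_lt.1 hle) s (by omega)) (not_lt.2 hν)
  have h1 := (hi (s' - s) (by omega) (by omega)).1
  simp only [pathFrom, Nat.add_sub_cancel' hs.le] at h1
  linarith [hR s hs]

/-- At the first alarm, the rise over the last minimum is an upward exit of the path restarted
there. -/
theorem exists_upExit_of_alarm {u : ℕ → Ω → ℝ} {ν : ℝ} {m : ℕ} {ω : Ω} (h : ω ∈ noAlarm u ν m)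
    (h' : ω ∉ noAlarm u ν (m + 1)) :
    ∃ s n, s + n = m + 1 ∧ ω ∈ recordLow u s ∧ pathFrom u s ω ∈ upExit ν n := by
  obtain ⟨s, hs, h1, h2⟩ := exists_last_min (fun i => u i ω) m
  refine ⟨s, m + 1 - s, by omega, fun r hr => h1 r (hr.le.trans hs), by omega, ?_, ?_⟩
  · simp only [noAlarm, mem_ofPred_eq, not_forall, not_lt] at h'
    obtain ⟨t, ht, r, hr, hν⟩ := h'
    have ht' : t = m + 1 := by
      by_contra hne
      exact absurd (h t (by omega) r hr) (not_lt.2 hν)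
    subst ht'
    have := h1 r (by omega)
    simp only [pathFrom, Nat.add_sub_cancel' (hs.trans m.le_succ)]
    linarith
  · intro i hi hi'
    exact ⟨sub_pos.2 (h2 (s + i) (by omega) (by omega)), h (s + i) (by omega) s (by omega)⟩

theorem tsum_ite_le_sub (g : ℕ → ℝ≥0∞) (s : ℕ) :
    ∑' n, (if s ≤ n then g (n - s) else 0) = ∑' j, g j := by
  rw [← (add_right_injective s).tsum_eq]
  · simp
  · intro n hn
    have : s ≤ n := by
      by_contra h
      simp [h] at hn
    exact ⟨n - s, Nat.add_sub_cancel' this⟩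

/-- A form of **Jensen's inequality** for the exponential function that needs no integrability of
`exp (-f)`. -/
theorem ofReal_exp_neg_integral_le {Q : Measure Ω} [IsProbabilityMeasure Q] {f : Ω → ℝ}
    (hf : Integrable f Q) :
    ENNReal.ofReal (Real.exp (-∫ ω, f ω ∂Q)) ≤ ∫⁻ ω, ENNReal.ofReal (Real.exp (-f ω)) ∂Q := by
  set m := ∫ ω, f ω ∂Q
  -- the tangent of `exp` at `-m`
  let g : Ω → ℝ := fun ω => Real.exp (-m) * (1 + m - f ω)
  have hg : Integrable g Q := ((integrable_const _).sub hf).const_mul _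
  have hgm : ∫ ω, g ω ∂Q = Real.exp (-m) := by
    simp only [g]
    rw [integral_const_mul, integral_sub (integrable_const _) hf]
    simp [m]
  rw [← hgm, integral_eq_lintegral_pos_part_sub_lintegral_neg_part hg]
  refine (ENNReal.ofReal_le_ofReal (sub_le_self _ ENNReal.toReal_nonneg)).trans
    (ENNReal.ofReal_toReal_le.trans (lintegral_mono fun ω => ENNReal.ofReal_le_ofReal ?_))
  have h1 : Real.exp (-f ω) = Real.exp (-m) * Real.exp (m - f ω) := by
    rw [← Real.exp_add]; congr 1; ring
  rw [h1]
  exact mul_le_mul_of_nonneg_left (by linarith [Real.add_one_le_exp (m - f ω)])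
    (Real.exp_pos _).le

/-! ### Change of measure and the expected time to a false alarm -/

section Pair

variable {P Q : Measure Ω} {F : Filtration ℕ mΩ} {u : ℕ → Ω → ℝ} {μ η : Measure ℝ}

theorem IsWalkFrom.measurableSet_noAlarm {τ : ℕ} (h : IsWalkFrom P F u τ μ) (ν : ℝ) (n : ℕ) :
    MeasurableSet[F n] (noAlarm u ν n) := by
  have : noAlarm u ν n = ⋂ t, ⋂ (_ : t ≤ n), ⋂ s, ⋂ (_ : s < t), {ω | u t ω - u s ω < ν} := by
    ext ω; simp [noAlarm]
  rw [this]
  refine MeasurableSet.iInter fun t => MeasurableSet.iInter fun ht => MeasurableSet.iInter fun s =>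
    MeasurableSet.iInter fun hs => ?_
  exact ((h.measurable_filtration ht).sub (h.measurable_filtration (hs.le.trans ht)))
    measurableSet_Iio

theorem IsWalkFrom.measurableSet_recordLow {τ : ℕ} (h : IsWalkFrom P F u τ μ) (s : ℕ) :
    MeasurableSet[F s] (recordLow u s) := by
  have : recordLow u s = ⋂ r, ⋂ (_ : r < s), {ω | u s ω - u r ω ≤ 0} := by
    ext ω; simp [recordLow]
  rw [this]
  refine MeasurableSet.iInter fun r => MeasurableSet.iInter fun hr => ?_
  exact ((h.adapted s).sub (h.measurable_filtration hr.le)) measurableSet_Iic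

theorem IsWalkFrom.measurableSet_upExit {τ : ℕ} (h : IsWalkFrom P F u τ μ) (ν : ℝ) (n : ℕ) :
    MeasurableSet[F n] {ω | (fun i => u i ω) ∈ upExit ν n} := by
  by_cases hn : 1 ≤ n
  · have : {ω | (fun i => u i ω) ∈ upExit ν n} = (u n ⁻¹' Ici ν) ∩
        ⋂ i, ⋂ (_ : i < n), ⋂ (_ : 1 ≤ i), u i ⁻¹' Ioo 0 ν := by
      ext ω; simp [upExit, hn]
    rw [this]
    refine ((h.adapted n) measurableSet_Ici).inter (MeasurableSet.iInter fun i =>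
      MeasurableSet.iInter fun hi => MeasurableSet.iInter fun _ => ?_)
    exact (h.measurable_filtration hi.le) measurableSet_Ioo
  · have : {ω | (fun i => u i ω) ∈ upExit ν n} = ∅ := by
      ext ω; simp [upExit, hn]
    rw [this]
    exact @MeasurableSet.empty _ (F n)

/-- The expectations of `exp (-u_n / 2)` form a geometric sequence, with ratio the Hellinger
affinity `ρ` of one step. -/
theorem IsWalkFrom.lintegral_exp_half [IsProbabilityMeasure Q] (h : IsWalkFrom Q F u 0 η) (n : ℕ) :
    ∫⁻ ω, ENNReal.ofReal (Real.exp (-u n ω / 2)) ∂Q =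
      (∫⁻ ω, ENNReal.ofReal (Real.exp (-u 1 ω / 2)) ∂Q) ^ n := by
  have hexp : Measurable fun x : ℝ => ENNReal.ofReal (Real.exp (-x / 2)) := by fun_prop
  have hstep : ∀ n, ∫⁻ ω, ENNReal.ofReal (Real.exp (-(u (n + 1) ω - u n ω) / 2)) ∂Q =
      ∫⁻ x, ENNReal.ofReal (Real.exp (-x / 2)) ∂η := fun n => by
    rw [← h.map_step n (Nat.zero_le _), lintegral_map hexp (h.measurable_step n)]
  have h1 : ∫⁻ ω, ENNReal.ofReal (Real.exp (-u 1 ω / 2)) ∂Q =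
      ∫⁻ x, ENNReal.ofReal (Real.exp (-x / 2)) ∂η := by
    rw [← hstep 0]
    simp [h.zero]
  rw [h1]
  induction n with
  | zero => simp [h.zero]
  | succ n ih =>
    rw [pow_succ, ← ih, ← hstep n]
    refine Eq.trans (lintegral_congr fun ω => ?_)
      (lintegral_mul_eq_lintegral_mul_lintegral_of_independent_measurableSpace
        (F.le n) (h.measurable_step n).comap_le (h.indep n (Nat.zero_le _)).symm
        (hexp.comp (h.adapted n)) (hexp.comp (comap_measurable _)))
    rw [← ENNReal.ofReal_mul (Real.exp_pos _).le, ← Real.exp_add]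
    congr 2
    ring

/-- A Chernoff bound with the exponent `1/2`. -/
theorem IsWalkFrom.measure_le_le [IsProbabilityMeasure Q] (h : IsWalkFrom Q F u 0 η) (a : ℝ)
    (n : ℕ) : Q {ω | u n ω ≤ a} ≤ ENNReal.ofReal (Real.exp (a / 2)) *
      (∫⁻ ω, ENNReal.ofReal (Real.exp (-u 1 ω / 2)) ∂Q) ^ n := by
  have hm : MeasurableSet {ω | u n ω ≤ a} := (h.measurable n) measurableSet_Iic
  rw [← h.lintegral_exp_half n, ← lintegral_const_mul _ (by have := h.measurable n; fun_prop),
    ← lintegral_indicator_one hm]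
  refine lintegral_mono fun ω => ?_
  by_cases hω : u n ω ≤ a
  · rw [indicator_of_mem (show ω ∈ {ω | u n ω ≤ a} from hω), Pi.one_apply,
      ← ENNReal.ofReal_mul (Real.exp_pos _).le, ← Real.exp_add, ← ENNReal.ofReal_one]
    refine ENNReal.ofReal_le_ofReal (Real.one_le_exp (by linarith))
  · rw [indicator_of_notMem (by simpa using hω)]
    exact zero_le

theorem lintegral_eq_lintegral_mul_exp
    (hu : ∀ t, Measurable[F t] (u t))
    (hac : ∀ n A, MeasurableSet[F n] A → Q A = ∫⁻ ω in A, ENNReal.ofReal (Real.exp (u n ω)) ∂P)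
    {n : ℕ} {f : Ω → ℝ≥0∞} (hf : Measurable[F n] f) :
    ∫⁻ ω, f ω ∂Q = ∫⁻ ω, ENNReal.ofReal (Real.exp (u n ω)) * f ω ∂P := by
  have hd : Measurable fun ω => ENNReal.ofReal (Real.exp (u n ω)) := by
    have := (hu n).mono (F.le n) le_rfl
    fun_prop
  have ht : Q.trim (F.le n) =
      (P.withDensity fun ω => ENNReal.ofReal (Real.exp (u n ω))).trim (F.le n) := by
    refine @Measure.ext _ (F n) _ _ fun A hA => ?_
    rw [trim_measurableSet_eq _ hA, trim_measurableSet_eq _ hA, withDensity_apply _ (F.le n _ hA),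
      hac n A hA]
  rw [← lintegral_trim (F.le n) hf, ht, lintegral_trim (F.le n) hf,
    lintegral_withDensity_eq_lintegral_mul _ hd (hf.mono (F.le n) le_rfl)]
  rfl

/-- The change of measure from the post-change law `Q` back to the pre-change law `P`. -/
theorem measure_eq_setLIntegral_exp_neg
    (hu : ∀ t, Measurable[F t] (u t))
    (hac : ∀ n A, MeasurableSet[F n] A → Q A = ∫⁻ ω in A, ENNReal.ofReal (Real.exp (u n ω)) ∂P)
    {n : ℕ} {A : Set Ω} (hA : MeasurableSet[F n] A) :
    P A = ∫⁻ ω in A, ENNReal.ofReal (Real.exp (-u n ω)) ∂Q := by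
  have hA' := F.le n _ hA
  have hm : Measurable[F n] fun ω => ENNReal.ofReal (Real.exp (-u n ω)) :=
    ENNReal.measurable_ofReal.comp (Real.measurable_exp.comp (hu n).neg)
  rw [← lintegral_indicator hA', lintegral_eq_lintegral_mul_exp hu hac
    (Measurable.indicator (m := F n) hm hA), ← lintegral_indicator_one hA']
  refine lintegral_congr fun ω => ?_
  by_cases hω : ω ∈ A
  · simp only [indicator_of_mem hω, Pi.one_apply]
    rw [← ENNReal.ofReal_mul (Real.exp_pos _).le, ← Real.exp_add]
    simp
  · simp [hω]

variable [IsProbabilityMeasure P] [IsProbabilityMeasure Q]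

/-- Under the pre-change law, the expected length of a cycle that is not interrupted by an alarm is
at most `(1 - ρ)⁻¹`, with `ρ` the Hellinger affinity of one step. -/
theorem tsum_posPath_le (hP : IsWalkFrom P F u 0 μ) (hQ : IsWalkFrom Q F u 0 η)
    (hac : ∀ n A, MeasurableSet[F n] A → Q A = ∫⁻ ω in A, ENNReal.ofReal (Real.exp (u n ω)) ∂P) :
    ∑' j, walkLaw μ (posPath j) ≤
      (1 - ∫⁻ ω, ENNReal.ofReal (Real.exp (-u 1 ω / 2)) ∂Q)⁻¹ := by
  rw [← ENNReal.tsum_geometric]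
  refine ENNReal.tsum_le_tsum fun j => ?_
  rw [← hP.map_path, Measure.map_apply (measurable_pi_lambda _ hP.measurable)
    (measurableSet_posPath j)]
  rcases Nat.eq_zero_or_pos j with rfl | hj
  · simpa using prob_le_one
  · have hA : MeasurableSet[F j] {ω | 0 < u j ω} := (hP.adapted j) measurableSet_Ioi
    calc P ((fun ω i => u i ω) ⁻¹' posPath j) ≤ P {ω | 0 < u j ω} :=
          measure_mono fun ω hω => hω j le_rfl hj
      _ = ∫⁻ ω in {ω | 0 < u j ω}, ENNReal.ofReal (Real.exp (-u j ω)) ∂Q :=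
          measure_eq_setLIntegral_exp_neg hP.adapted hac hA
      _ ≤ ∫⁻ ω in {ω | 0 < u j ω}, ENNReal.ofReal (Real.exp (-u j ω / 2)) ∂Q := by
          refine setLIntegral_mono' (F.le j _ hA) fun ω hω => ?_
          have : 0 < u j ω := hω
          exact ENNReal.ofReal_le_ofReal (Real.exp_le_exp.2 (by linarith))
      _ ≤ ∫⁻ ω, ENNReal.ofReal (Real.exp (-u j ω / 2)) ∂Q := setLIntegral_le_lintegral _ _
      _ = _ := hQ.lintegral_exp_half j

/-- The number of cycles before an alarm, times the expected length of a cycle, bounds the expected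
time of the alarm. -/
theorem tsum_noAlarm_le (hP : IsWalkFrom P F u 0 μ) (ν : ℝ) :
    ∑' n, P (noAlarm u ν n) ≤
      (∑' s, P (noAlarm u ν s ∩ recordLow u s)) * ∑' j, walkLaw μ (posPath j) := by
  have hD : ∀ s, MeasurableSet[F s] (noAlarm u ν s ∩ recordLow u s) := fun s =>
    (hP.measurableSet_noAlarm ν s).inter (hP.measurableSet_recordLow s)
  calc ∑' n, P (noAlarm u ν n)
      ≤ ∑' n, ∑' s, if s ≤ n then
          P (noAlarm u ν s ∩ recordLow u s) * walkLaw μ (posPath (n - s)) else 0 := by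
        refine ENNReal.tsum_le_tsum fun n => (measure_mono (noAlarm_subset u ν n)).trans
          ((measure_iUnion_le _).trans (ENNReal.tsum_le_tsum fun s => ?_))
        split_ifs with hs
        · exact ((hP.mono (Nat.zero_le s)).measure_inter_pathFrom (hD s)
            (measurableSet_posPath _)).le
        · simp
    _ = ∑' s, ∑' n, if s ≤ n then
          P (noAlarm u ν s ∩ recordLow u s) * walkLaw μ (posPath (n - s)) else 0 :=
        ENNReal.tsum_comm
    _ = _ := by
        rw [← ENNReal.tsum_mul_right]
        refine tsum_congr fun s => ?_
        rw [tsum_ite_le_sub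
          (fun j => P (noAlarm u ν s ∩ recordLow u s) * walkLaw μ (posPath j)) s,
          ENNReal.tsum_mul_left]

theorem tsum_cycles_mul_le_one (hP : IsWalkFrom P F u 0 μ) (ν : ℝ) :
    (∑' s, P (noAlarm u ν s ∩ recordLow u s)) * walkLaw μ (⋃ n, upExit ν n) ≤ 1 := by
  have hB : MeasurableSet (⋃ n, upExit ν n) := MeasurableSet.iUnion (measurableSet_upExit ν)
  have hD : ∀ s, MeasurableSet[F s] (noAlarm u ν s ∩ recordLow u s) := fun s =>
    (hP.measurableSet_noAlarm ν s).inter (hP.measurableSet_recordLow s)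
  rw [← ENNReal.tsum_mul_right]
  simp_rw [← fun s => (hP.mono (Nat.zero_le s)).measure_inter_pathFrom (hD s) hB]
  rw [← measure_iUnion (pairwise_disjoint_cycles u ν)
    fun s => (F.le s _ (hD s)).inter (hP.measurable_pathFrom s hB)]
  exact prob_le_one

/-- The probability of an upward exit under the pre-change law as an expectation under the
post-change law. -/
theorem walkLaw_upExit (hP : IsWalkFrom P F u 0 μ) (hQ : IsWalkFrom Q F u 0 η)
    (hac : ∀ n A, MeasurableSet[F n] A → Q A = ∫⁻ ω in A, ENNReal.ofReal (Real.exp (u n ω)) ∂P)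
    (ν : ℝ) : walkLaw μ (⋃ n, upExit ν n) = ∫⁻ v, ∑' n,
      (upExit ν n).indicator (fun v => ENNReal.ofReal (Real.exp (-v n))) v ∂walkLaw η := by
  have hmeas : ∀ n, Measurable fun v : ℕ → ℝ => ENNReal.ofReal (Real.exp (-v n)) := by
    intro n; fun_prop
  have hpath : Measurable fun ω i => u i ω := measurable_pi_lambda _ hP.measurable
  rw [measure_iUnion (pairwise_disjoint_upExit ν) (measurableSet_upExit ν), lintegral_tsum
    fun n => ((hmeas n).indicator (measurableSet_upExit ν n)).aemeasurable]
  refine tsum_congr fun n => ?_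
  rw [lintegral_indicator (measurableSet_upExit ν n), ← hP.map_path, ← hQ.map_path,
    Measure.map_apply hpath (measurableSet_upExit ν n),
    setLIntegral_map (measurableSet_upExit ν n) (hmeas n) hpath]
  exact measure_eq_setLIntegral_exp_neg hP.adapted hac (hP.measurableSet_upExit ν n)

/-- If `U` is the value of the walk at the first alarm, the expected time of the
alarm under the pre-change law is at most exponential in the expectation of `U` under the post-change
law. -/
theorem tsum_noAlarm_le_exp (hP : IsWalkFrom P F u 0 μ) (hQ : IsWalkFrom Q F u 0 η)
    (hac : ∀ n A, MeasurableSet[F n] A → Q A = ∫⁻ ω in A, ENNReal.ofReal (Real.exp (u n ω)) ∂P)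
    {C : ℝ} (hC : 0 ≤ C)
    (hρ : (1 - ∫⁻ ω, ENNReal.ofReal (Real.exp (-u 1 ω / 2)) ∂Q)⁻¹ ≤ ENNReal.ofReal C) (ν : ℝ)
    {U : Ω → ℝ} (hU : Integrable U Q)
    (hUm : ∀ᵐ ω ∂Q, ∃ m, ω ∈ noAlarm u ν m ∧ ω ∉ noAlarm u ν (m + 1) ∧ U ω = u (m + 1) ω) :
    ∑' n, P (noAlarm u ν n) ≤ ENNReal.ofReal (C ^ 2 * Real.exp (∫ ω, U ω ∂Q + C)) := by
  -- `Z` dominates `-min u`, and its expectation is bounded through the affinity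
  let z : Ω → ℝ≥0∞ := fun ω => ∑' s, ENNReal.ofReal (-u s ω)
  have hzs : ∀ s, Measurable fun ω => ENNReal.ofReal (-u s ω) := fun s =>
    (hQ.measurable s).neg.ennreal_ofReal
  have hzm : Measurable z := Measurable.tsum hzs
  have hz : ∫⁻ ω, z ω ∂Q ≤ ENNReal.ofReal C := by
    refine le_trans ?_ hρ
    rw [lintegral_tsum fun s => (hzs s).aemeasurable,
      ← ENNReal.tsum_geometric]
    refine ENNReal.tsum_le_tsum fun s => ?_
    rw [← hQ.lintegral_exp_half s]
    refine lintegral_mono fun ω => ENNReal.ofReal_le_ofReal ?_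
    -- `x ≤ exp (x / 2)`
    have h1 := Real.add_one_le_exp (-u s ω / 4)
    have h2 : Real.exp (-u s ω / 2) = Real.exp (-u s ω / 4) ^ 2 := by
      rw [← Real.exp_nat_mul]; congr 1; push_cast; ring
    rw [h2]
    nlinarith [Real.exp_pos (-u s ω / 4), sq_nonneg (Real.exp (-u s ω / 4) - 2)]
  have hz' : ∫⁻ ω, z ω ∂Q ≠ ∞ := ne_top_of_le_ne_top ENNReal.ofReal_ne_top hz
  have hzfin : ∀ᵐ ω ∂Q, z ω < ∞ := ae_lt_top hzm hz'
  have hZint : Integrable (fun ω => (z ω).toReal) Q := integrable_toReal_of_lintegral_ne_top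
    hzm.aemeasurable hz'
  have hZle : ∫ ω, (z ω).toReal ∂Q ≤ C := by
    rw [integral_toReal hzm.aemeasurable hzfin]
    exact ENNReal.toReal_le_of_le_ofReal hC hz
  set β := walkLaw μ (⋃ n, upExit ν n) with hβ
  let b : (ℕ → ℝ) → ℝ≥0∞ := fun v =>
    ∑' n, (upExit ν n).indicator (fun v => ENNReal.ofReal (Real.exp (-v n))) v
  have hb : Measurable b := Measurable.tsum fun n =>
    Measurable.indicator (by fun_prop) (measurableSet_upExit ν n)
  have hpt : ∀ᵐ ω ∂Q, ENNReal.ofReal (Real.exp (-(U ω + (z ω).toReal))) ≤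
      ∑' s, (recordLow u s).indicator (fun ω => b (pathFrom u s ω)) ω := by
    filter_upwards [hUm, hzfin] with ω ⟨m, hm, hm', hUω⟩ hzω
    obtain ⟨s, n, hsn, hs, hn⟩ := exists_upExit_of_alarm hm hm'
    refine le_trans ?_ (ENNReal.le_tsum s)
    rw [indicator_of_mem hs]
    refine le_trans ?_ (ENNReal.le_tsum n)
    rw [indicator_of_mem hn]
    refine ENNReal.ofReal_le_ofReal (Real.exp_le_exp.2 ?_)
    have h1 : -u s ω ≤ (z ω).toReal :=
      (ENNReal.ofReal_le_iff_le_toReal hzω.ne).1 (ENNReal.le_tsum (f := fun s =>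
        ENNReal.ofReal (-u s ω)) s)
    simp only [pathFrom, hsn, hUω]
    linarith
  have hQrec : ∑' s, Q (recordLow u s) ≤ ENNReal.ofReal C := by
    refine le_trans ?_ hρ
    rw [← ENNReal.tsum_geometric]
    refine ENNReal.tsum_le_tsum fun s => ?_
    rcases Nat.eq_zero_or_pos s with rfl | hs
    · simpa using prob_le_one
    · refine (measure_mono fun ω hω => ?_).trans ((hQ.measure_le_le 0 s).trans (by simp))
      simpa [hQ.zero] using hω 0 hs
  have hexp : ENNReal.ofReal (Real.exp (-(∫ ω, U ω ∂Q + C))) ≤ ENNReal.ofReal C * β := by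
    calc ENNReal.ofReal (Real.exp (-(∫ ω, U ω ∂Q + C)))
        ≤ ENNReal.ofReal (Real.exp (-∫ ω, (U ω + (z ω).toReal) ∂Q)) := by
          rw [integral_add hU hZint]
          exact ENNReal.ofReal_le_ofReal (Real.exp_le_exp.2 (by linarith))
      _ ≤ ∫⁻ ω, ENNReal.ofReal (Real.exp (-(U ω + (z ω).toReal))) ∂Q :=
          ofReal_exp_neg_integral_le (hU.add hZint)
      _ ≤ ∫⁻ ω, ∑' s, (recordLow u s).indicator (fun ω => b (pathFrom u s ω)) ω ∂Q :=
          lintegral_mono_ae hpt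
      _ = ∑' s, Q (recordLow u s) * β := by
          have hbs : ∀ s, Measurable ((recordLow u s).indicator fun ω => b (pathFrom u s ω)) :=
            fun s => (hb.comp (hQ.measurable_pathFrom s)).indicator
              (F.le s _ (hQ.measurableSet_recordLow s))
          rw [lintegral_tsum fun s => (hbs s).aemeasurable]
          refine tsum_congr fun s => ?_
          rw [lintegral_indicator (F.le s _ (hQ.measurableSet_recordLow s)),
            (hQ.mono (Nat.zero_le s)).setLIntegral_pathFrom (hQ.measurableSet_recordLow s) hb,
            hβ, walkLaw_upExit hP hQ hac ν]
      _ ≤ ENNReal.ofReal C * β := by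
          rw [ENNReal.tsum_mul_right]
          gcongr
  set x := ∑' s, P (noAlarm u ν s ∩ recordLow u s)
  have hone : ENNReal.ofReal (Real.exp (-(∫ ω, U ω ∂Q + C))) *
      ENNReal.ofReal (Real.exp (∫ ω, U ω ∂Q + C)) = 1 := by
    rw [← ENNReal.ofReal_mul (Real.exp_pos _).le, ← Real.exp_add]
    simp
  have hx : x ≤ ENNReal.ofReal C * ENNReal.ofReal (Real.exp (∫ ω, U ω ∂Q + C)) := by
    calc x = x * ENNReal.ofReal (Real.exp (-(∫ ω, U ω ∂Q + C))) *
          ENNReal.ofReal (Real.exp (∫ ω, U ω ∂Q + C)) := by rw [mul_assoc, hone, mul_one]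
      _ ≤ x * (ENNReal.ofReal C * β) * ENNReal.ofReal (Real.exp (∫ ω, U ω ∂Q + C)) := by gcongr
      _ = (x * β) * (ENNReal.ofReal C * ENNReal.ofReal (Real.exp (∫ ω, U ω ∂Q + C))) := by ring
      _ ≤ 1 * (ENNReal.ofReal C * ENNReal.ofReal (Real.exp (∫ ω, U ω ∂Q + C))) := by
          gcongr
          exact tsum_cycles_mul_le_one hP ν
      _ = _ := one_mul _
  calc ∑' n, P (noAlarm u ν n) ≤ x * ∑' j, walkLaw μ (posPath j) := tsum_noAlarm_le hP ν
    _ ≤ (ENNReal.ofReal C * ENNReal.ofReal (Real.exp (∫ ω, U ω ∂Q + C))) * ENNReal.ofReal C := by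
        gcongr
        exact (tsum_posPath_le hP hQ hac).trans hρ
    _ = _ := by
        rw [ENNReal.ofReal_mul (sq_nonneg C), ENNReal.ofReal_pow hC]
        ring

/-- Under the post-change law the alarm comes after a finite expected time. -/
theorem tsum_noAlarm_ne_top (hQ : IsWalkFrom Q F u 0 η) {C : ℝ}
    (hρ : (1 - ∫⁻ ω, ENNReal.ofReal (Real.exp (-u 1 ω / 2)) ∂Q)⁻¹ ≤ ENNReal.ofReal C) (ν : ℝ) :
    ∑' n, Q (noAlarm u ν n) ≠ ∞ := by
  set ρ := ∫⁻ ω, ENNReal.ofReal (Real.exp (-u 1 ω / 2)) ∂Q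
  have hle : ∀ n, Q (noAlarm u ν (n + 1)) ≤ ENNReal.ofReal (Real.exp (ν / 2)) * ρ ^ (n + 1) := by
    intro n
    refine (measure_mono fun ω hω => ?_).trans (hQ.measure_le_le ν (n + 1))
    have := hω (n + 1) le_rfl 0 n.succ_pos
    rw [hQ.zero, sub_zero] at this
    exact this.le
  have hgeom : ∑' n : ℕ, ρ ^ (n + 1) ≤ ENNReal.ofReal C := by
    refine le_trans ?_ hρ
    rw [← ENNReal.tsum_geometric]
    exact ENNReal.tsum_comp_le_tsum_of_injective (add_left_injective 1) fun n => ρ ^ n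
  rw [tsum_eq_zero_add' ENNReal.summable]
  refine ENNReal.add_ne_top.2 ⟨measure_ne_top _ _, ne_top_of_le_ne_top ?_
    (ENNReal.tsum_le_tsum hle)⟩
  rw [ENNReal.tsum_mul_left]
  exact ENNReal.mul_ne_top ENNReal.ofReal_ne_top
    (ne_top_of_le_ne_top ENNReal.ofReal_ne_top hgeom)

end Pair

/-! ### The Hellinger affinity of one step -/

/-- The bound on `(1 - ρ)⁻¹`, for `ρ` the Hellinger affinity of one step, in terms of the bounds on
the first two moments of the step. -/
def affinityBound (c V : ℝ) : ℝ := 8 * V / ((1 - Real.exp (-c / 4)) ^ 2 * c ^ 2)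

theorem affinityBound_pos {c V : ℝ} (hc : 0 < c) (hV : 0 < V) : 0 < affinityBound c V := by
  have : Real.exp (-c / 4) < 1 := Real.exp_lt_one_iff.2 (by linarith)
  have h2 : 0 < (1 - Real.exp (-c / 4)) ^ 2 := pow_pos (by linarith) 2
  unfold affinityBound
  positivity

/-- A log-likelihood ratio with large mean and controlled second moment has Hellinger affinity
`E exp (-X / 2)` bounded away from `1`, uniformly in the scale `k` of the mean. -/
theorem inv_one_sub_affinity_le {Q : Measure Ω} [IsProbabilityMeasure Q] {X : Ω → ℝ}
    (hXm : Measurable X) (hX : Integrable X Q) (hX2 : Integrable (fun ω => X ω ^ 2) Q)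
    (hexp : ∫⁻ ω, ENNReal.ofReal (Real.exp (-X ω)) ∂Q ≤ 1) {c V k : ℝ} (hc : 0 < c) (hV : 0 < V)
    (hk : 1 ≤ k) (hmean : c * k ≤ ∫ ω, X ω ∂Q) (hsq : ∫ ω, X ω ^ 2 ∂Q ≤ V * k ^ 2) :
    (1 - ∫⁻ ω, ENNReal.ofReal (Real.exp (-X ω / 2)) ∂Q)⁻¹ ≤ ENNReal.ofReal (affinityBound c V) := by
  set κ := (1 - Real.exp (-c / 4)) ^ 2 with hκ
  have hκ0 : 0 < κ := by
    have : Real.exp (-c / 4) < 1 := Real.exp_lt_one_iff.2 (by linarith)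
    exact pow_pos (by linarith) 2
  set l := c / (V * k) with hl
  have hk0 : 0 < k := by linarith
  have hl0 : 0 < l := by positivity
  have hE : Integrable (fun ω => Real.exp (-X ω)) Q := by
    refine ⟨(by fun_prop : Measurable fun ω => Real.exp (-X ω)).aestronglyMeasurable, ?_⟩
    rw [hasFiniteIntegral_iff_ofReal (ae_of_all _ fun ω => (Real.exp_pos _).le)]
    exact hexp.trans_lt ENNReal.one_lt_top
  have hE1 : ∫ ω, Real.exp (-X ω) ∂Q ≤ 1 := by
    rw [integral_eq_lintegral_of_nonneg_ae (ae_of_all _ fun ω => (Real.exp_pos _).le)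
      hE.aestronglyMeasurable]
    exact ENNReal.toReal_le_of_le_ofReal zero_le_one (by simpa using hexp)
  have hsquare : ∀ ω, Real.exp (-X ω) = Real.exp (-X ω / 2) ^ 2 := fun ω => by
    rw [← Real.exp_nat_mul]; congr 1; push_cast; ring
  have hG : Integrable (fun ω => Real.exp (-X ω / 2)) Q := by
    refine Integrable.mono' ((integrable_const 1).add hE)
      (by fun_prop : Measurable fun ω => Real.exp (-X ω / 2)).aestronglyMeasurable
      (ae_of_all _ fun ω => ?_)
    simp only [Pi.add_apply]
    rw [Real.norm_of_nonneg (Real.exp_pos _).le, hsquare ω]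
    nlinarith [sq_nonneg (Real.exp (-X ω / 2) - 1), Real.exp_pos (-X ω / 2)]
  -- on `X ≥ c k / 2` the left side is at most `κ` and the right side at least `κ`, while elsewhere
  -- the left side is negative
  have hpt : ∀ ω, κ * (l * (X ω - c * k / 2) - l ^ 2 / 4 * X ω ^ 2) ≤
      1 - 2 * Real.exp (-X ω / 2) + Real.exp (-X ω) := by
    intro ω
    rw [hsquare ω]
    have e1 : 1 - 2 * Real.exp (-X ω / 2) + Real.exp (-X ω / 2) ^ 2 =
        (1 - Real.exp (-X ω / 2)) ^ 2 := by ring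
    rw [e1]
    rcases le_or_gt (c * k / 2) (X ω) with h | h
    · have h1 : l * (X ω - c * k / 2) - l ^ 2 / 4 * X ω ^ 2 ≤ 1 := by
        nlinarith [sq_nonneg (l * X ω / 2 - 1), mul_pos hl0 (mul_pos hc hk0)]
      have h2 : κ ≤ (1 - Real.exp (-X ω / 2)) ^ 2 := by
        have h3 : Real.exp (-X ω / 2) ≤ Real.exp (-c / 4) :=
          Real.exp_le_exp.2 (by nlinarith)
        have h4 : Real.exp (-c / 4) < 1 := Real.exp_lt_one_iff.2 (by linarith)
        exact pow_le_pow_left₀ (by linarith) (by linarith) 2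
      nlinarith
    · refine le_trans ?_ (sq_nonneg _)
      have h1 : l * (X ω - c * k / 2) < 0 := mul_neg_of_pos_of_neg hl0 (by linarith)
      have h2 : 0 ≤ l ^ 2 / 4 * X ω ^ 2 := by positivity
      exact mul_nonpos_of_nonneg_of_nonpos hκ0.le (by linarith)
  have hX' : Integrable (fun ω => l * (X ω - c * k / 2)) Q :=
    (hX.sub (integrable_const (c * k / 2))).const_mul l
  have hX2' : Integrable (fun ω => l ^ 2 / 4 * X ω ^ 2) Q := hX2.const_mul _
  have hG' : Integrable (fun ω => 1 - 2 * Real.exp (-X ω / 2)) Q :=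
    (integrable_const 1).sub (hG.const_mul 2)
  have hint := integral_mono (μ := Q) ((hX'.sub hX2').const_mul κ) (hG'.add hE) hpt
  simp only [Pi.add_apply, Pi.sub_apply] at hint
  rw [integral_const_mul, integral_sub hX' hX2', integral_const_mul, integral_const_mul,
    integral_sub hX (integrable_const _), integral_add hG' hE,
    integral_sub (integrable_const _) (hG.const_mul 2), integral_const_mul] at hint
  simp only [integral_const, probReal_univ, smul_eq_mul, one_mul] at hint
  have hδ : (affinityBound c V)⁻¹ = κ * (c ^ 2 / (8 * V)) := by
    rw [affinityBound, inv_div]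
    ring
  have hr : ∫ ω, Real.exp (-X ω / 2) ∂Q ≤ 1 - (affinityBound c V)⁻¹ := by
    have h1 : l * (c * k / 2) ≤ l * (∫ ω, X ω ∂Q - c * k / 2) :=
      mul_le_mul_of_nonneg_left (by linarith) hl0.le
    have h2 : l ^ 2 / 4 * ∫ ω, X ω ^ 2 ∂Q ≤ l ^ 2 / 4 * (V * k ^ 2) :=
      mul_le_mul_of_nonneg_left hsq (by positivity)
    have h3 : l * (c * k / 2) - l ^ 2 / 4 * (V * k ^ 2) = 2 * (c ^ 2 / (8 * V)) := by
      rw [hl]; field_simp; ring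
    have h4 := mul_le_mul_of_nonneg_left (show 2 * (c ^ 2 / (8 * V)) ≤
      l * (∫ ω, X ω ∂Q - c * k / 2) - l ^ 2 / 4 * ∫ ω, X ω ^ 2 ∂Q by linarith) hκ0.le
    rw [hδ]
    linarith
  have hpos := affinityBound_pos hc hV
  rw [← ofReal_integral_eq_lintegral_ofReal hG (ae_of_all _ fun ω => (Real.exp_pos _).le),
    ← ENNReal.ofReal_one, ← ENNReal.ofReal_sub _ (integral_nonneg fun ω => (Real.exp_pos _).le),
    ← inv_inv (affinityBound c V), ENNReal.ofReal_inv_of_pos (inv_pos.2 hpos)]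
  exact ENNReal.inv_le_inv.2 (ENNReal.ofReal_le_ofReal (by linarith))

end Walk

/-! ### The sensors -/

theorem localFiltration_zero : (localFiltration 0 : MeasurableSpace (ℕ → ℝ)) = ⊥ := by
  refine le_antisymm (iSup₂_le fun j hj => ?_) bot_le
  obtain rfl := Nat.le_zero.1 hj
  exact (MeasurableSpace.comap_const (0 : ℝ)).le

theorem globalFiltration_zero (K : ℕ) :
    (globalFiltration K 0 : MeasurableSpace (Path K)) = ⊥ := by
  refine le_antisymm (iSup_le fun k => ?_) bot_le
  rw [localFiltration_zero, MeasurableSpace.comap_bot]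

namespace Sensor

variable (M : Sensor)

theorem u_zero (x : ℕ → ℝ) : M.u 0 x = 0 := by
  have htrim : M.P0.trim (localFiltration.le 0) = M.Pinf.trim (localFiltration.le 0) := by
    refine @Measure.ext _ (localFiltration 0) _ _ fun A hA => ?_
    rw [trim_measurableSet_eq _ hA, trim_measurableSet_eq _ hA]
    rw [localFiltration_zero, MeasurableSpace.measurableSet_bot_iff] at hA
    rcases hA with rfl | rfl <;> simp
  have hm : Measurable[⊥] (M.u 0) := by
    rw [← localFiltration_zero]; exact M.measurable_u 0
  obtain ⟨a, ha⟩ := eq_const_of_measurable_bot hm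
  have h0 : M.u 0 =ᵐ[M.Pinf.trim (localFiltration.le 0)] 0 := by
    rw [u, htrim]
    exact llr_self _
  obtain ⟨x', hx'⟩ := (ae_of_ae_trim _ h0).exists
  rw [ha] at hx' ⊢
  exact hx'

theorem measurable_u' (t : ℕ) : Measurable (M.u t) :=
  (M.measurable_u t).mono (localFiltration.le t) le_rfl

theorem law_zero : M.law (0 : ℕ) = M.P0 := by
  simp [law, M.u_zero]

theorem law_apply_self {n : ℕ} {A : Set (ℕ → ℝ)} (hA : MeasurableSet[localFiltration n] A) :
    M.law n A = M.Pinf A := by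
  rw [← trim_measurableSet_eq (localFiltration.le n) hA, M.law_trim_self n,
    trim_measurableSet_eq _ hA]

theorem P0_apply {t : ℕ} {A : Set (ℕ → ℝ)} (hA : MeasurableSet[localFiltration t] A) :
    M.P0 A = ∫⁻ x in A, ENNReal.ofReal (Real.exp (M.u t x)) ∂M.Pinf := by
  have hm : Measurable[localFiltration t] fun x => ENNReal.ofReal (Real.exp (M.u t x)) :=
    ENNReal.measurable_ofReal.comp (Real.measurable_exp.comp (M.measurable_u t))
  have h := M.law_trim (Nat.zero_le t)
  simp only [M.u_zero, sub_zero, M.law_zero] at h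
  rw [← trim_measurableSet_eq (localFiltration.le t) hA, h, withDensity_apply _ hA,
    restrict_trim (localFiltration.le t) _ hA, lintegral_trim _ hm]

instance isProbabilityMeasure_law (τ : WithTop ℕ) : IsProbabilityMeasure (M.law τ) := by
  cases τ with
  | top => exact M.isProbInf
  | coe n => exact ⟨(M.law_apply_self (n := n) MeasurableSet.univ).trans measure_univ⟩

/-- After the change the steps of the log-likelihood ratio are independent of the past and have
their post-change law. -/
theorem law_inter_step (h : M.IsRandomWalk M.P0) {n t : ℕ} (hnt : n ≤ t) {A : Set (ℕ → ℝ)}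
    (hA : MeasurableSet[localFiltration t] A) {B : Set ℝ} (hB : MeasurableSet B) :
    M.law n ((fun x => M.u (t + 1) x - M.u t x) ⁻¹' B ∩ A) = M.P0 (M.u 1 ⁻¹' B) * M.law n A := by
  have hstep : Measurable fun x => M.u (t + 1) x - M.u t x :=
    (M.measurable_u' _).sub (M.measurable_u' _)
  have hA' := localFiltration.le t _ hA
  have hm : Measurable[localFiltration t] fun x => ENNReal.ofReal (Real.exp (-M.u n x)) :=
    ENNReal.measurable_ofReal.comp (Real.measurable_exp.comp
      ((M.measurable_u n).mono (localFiltration.mono hnt) le_rfl).neg)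
  have hid : M.P0 ((fun x => M.u (t + 1) x - M.u t x) ⁻¹' B) = M.P0 (M.u 1 ⁻¹' B) :=
    (h t).2.measure_preimage_eq hB
  have hind := lintegral_mul_eq_lintegral_mul_lintegral_of_independent_measurableSpace
    (f := ((fun x => M.u (t + 1) x - M.u t x) ⁻¹' B).indicator fun _ => (1 : ℝ≥0∞))
    (g := A.indicator fun x => ENNReal.ofReal (Real.exp (-M.u n x)))
    hstep.comap_le (localFiltration.le t) (h t).1
    (Measurable.indicator (m := MeasurableSpace.comap (fun x => M.u (t + 1) x - M.u t x) _)
      measurable_const ⟨B, hB, rfl⟩)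
    (Measurable.indicator (m := localFiltration t) hm hA)
  rw [lintegral_indicator_const (hstep hB), one_mul, hid, lintegral_indicator hA'] at hind
  change M.P0.withDensity (fun x => ENNReal.ofReal (Real.exp (-M.u n x))) _ =
    _ * M.P0.withDensity (fun x => ENNReal.ofReal (Real.exp (-M.u n x))) A
  rw [withDensity_apply _ hA', withDensity_apply _ ((hstep hB).inter hA'), ← hind,
    ← lintegral_indicator ((hstep hB).inter hA')]
  refine lintegral_congr fun x => ?_
  rw [← inter_indicator_mul]
  simp

theorem indep_step (h : M.IsRandomWalk M.P0) {n t : ℕ} (hnt : n ≤ t) :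
    Indep (MeasurableSpace.comap (fun x => M.u (t + 1) x - M.u t x) inferInstance)
      (localFiltration t) (M.law n) := by
  refine (Indep_iff _ _ _).2 ?_
  rintro _ A ⟨B, hB, rfl⟩ hA
  rw [M.law_inter_step h hnt hA hB]
  have := M.law_inter_step h hnt MeasurableSet.univ hB
  rw [inter_univ, measure_univ, mul_one] at this
  rw [this]

theorem map_step (h : M.IsRandomWalk M.P0) {n t : ℕ} (hnt : n ≤ t) :
    (M.law n).map (fun x => M.u (t + 1) x - M.u t x) = M.P0.map (M.u 1) := by
  ext B hB
  have := M.law_inter_step h hnt MeasurableSet.univ hB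
  rw [inter_univ, measure_univ, mul_one] at this
  have hstep : Measurable fun x => M.u (t + 1) x - M.u t x :=
    (M.measurable_u' _).sub (M.measurable_u' _)
  rw [Measure.map_apply hstep hB, Measure.map_apply (M.measurable_u' 1) hB, this]

end Sensor

/-! ### The network of sensors -/

section Network

variable {K : ℕ}

/-- Independence on each factor of a product of probability spaces gives independence on the
product. -/
theorem indep_pi {ι : Type*} [Fintype ι] {α : Type*} [mα : MeasurableSpace α] {P : ι → Measure α}
    [∀ k, IsProbabilityMeasure (P k)] {m₁ m₂ : ι → MeasurableSpace α} (h₁ : ∀ k, m₁ k ≤ mα)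
    (h₂ : ∀ k, m₂ k ≤ mα) (h : ∀ k, Indep (m₁ k) (m₂ k) (P k)) :
    Indep (⨆ k, (m₁ k).comap fun ω : ι → α => ω k) (⨆ k, (m₂ k).comap fun ω : ι → α => ω k)
      (Measure.pi P) := by
  have hle : ∀ m : ι → MeasurableSpace α, (∀ k, m k ≤ mα) →
      (⨆ k, (m k).comap fun ω : ι → α => ω k) ≤ MeasurableSpace.pi := fun m hm =>
    iSup_le fun k => (MeasurableSpace.comap_mono (hm k)).trans (measurable_pi_apply k).comap_le
  refine IndepSets.indep (hle m₁ h₁) (hle m₂ h₂) (@isPiSystem_pi ι (fun _ => α) m₁)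
    (@isPiSystem_pi ι (fun _ => α) m₂) (@generateFrom_pi ι (fun _ => α) _ m₁).symm
    (@generateFrom_pi ι (fun _ => α) _ m₂).symm ?_
  refine (IndepSets_iff _ _ _).2 ?_
  rintro _ _ ⟨s, hs, rfl⟩ ⟨t, ht, rfl⟩
  rw [← pi_inter_distrib, Measure.pi_pi, Measure.pi_pi, Measure.pi_pi, ← Finset.prod_mul_distrib]
  exact Finset.prod_congr rfl fun k _ =>
    (Indep_iff _ _ _).1 (h k) _ _ (hs k (mem_univ k)) (ht k (mem_univ k))

variable (M : Fin K → Sensor)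

instance isProbabilityMeasure_law (τ : WithTop ℕ) : IsProbabilityMeasure (law M τ) := by
  unfold law; infer_instance

theorem u_zero (ω : Path K) : u M 0 ω = 0 := by
  simp [u, Sensor.u_zero]

theorem measurable_u (t : ℕ) : Measurable[globalFiltration K t] (u M t) := by
  refine Finset.measurable_sum _ fun k _ => ?_
  exact ((M k).measurable_u t).comp
    ((comap_measurable _).mono (le_iSup (fun k : Fin K =>
      (localFiltration t).comap fun ω : Path K => ω k) k) le_rfl)

/-- The law of the sum of independent real variables with laws `μ k`. -/
def sumLaw (μ : Fin K → Measure ℝ) : Measure ℝ :=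
  (Measure.pi μ).map fun x => ∑ k, x k

theorem isWalkFrom_of_sensors {τ : WithTop ℕ} {n : ℕ} {μ : Fin K → Measure ℝ}
    (hind : ∀ k t, n ≤ t → Indep
      (MeasurableSpace.comap (fun x => (M k).u (t + 1) x - (M k).u t x) inferInstance)
      (localFiltration t) ((M k).law τ))
    (hmap : ∀ k t, n ≤ t → ((M k).law τ).map (fun x => (M k).u (t + 1) x - (M k).u t x) = μ k) :
    IsWalkFrom (law M τ) (globalFiltration K) (u M) n (sumLaw μ) := by
  have hstep : ∀ k t, Measurable fun x => (M k).u (t + 1) x - (M k).u t x := fun k t =>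
    ((M k).measurable_u' _).sub ((M k).measurable_u' _)
  have hsum : ∀ t, (fun ω => u M (t + 1) ω - u M t ω) =
      fun ω : Path K => ∑ k, ((M k).u (t + 1) (ω k) - (M k).u t (ω k)) := fun t => by
    funext ω
    simp [u, Finset.sum_sub_distrib]
  refine ⟨u_zero M, measurable_u M, fun t ht => ?_, fun t ht => ?_⟩
  · refine indep_of_indep_of_le_left (indep_pi (fun k => (hstep k t).comap_le)
      (fun _ => localFiltration.le t) fun k => hind k t ht) ?_
    rw [hsum]
    refine Measurable.comap_le (Finset.measurable_sum _ fun k _ => ?_)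
    refine Measurable.mono (ma := MeasurableSpace.comap
      (fun ω : Path K => ω k) (MeasurableSpace.comap
        (fun x => (M k).u (t + 1) x - (M k).u t x) inferInstance)) ?_
      (le_iSup (fun k : Fin K => (MeasurableSpace.comap (fun x => (M k).u (t + 1) x - (M k).u t x)
        inferInstance).comap fun ω : Path K => ω k) k) le_rfl
    rw [MeasurableSpace.comap_comp]
    exact comap_measurable _
  · have hμ : ∀ k, IsProbabilityMeasure (((M k).law τ).map
        fun x => (M k).u (t + 1) x - (M k).u t x) := fun k =>
      Measure.isProbabilityMeasure_map (hstep k t).aemeasurable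
    have := Measure.pi_map_pi (μ := fun k => (M k).law τ) fun k => (hstep k t).aemeasurable
    simp_rw [hmap _ t ht] at this
    have hpi : Measurable fun (ω : Path K) k => (M k).u (t + 1) (ω k) - (M k).u t (ω k) :=
      measurable_pi_lambda _ fun k => (hstep k t).comp (measurable_pi_apply k)
    rw [sumLaw, ← this, hsum, Measure.map_map (by fun_prop) hpi]
    rfl

theorem isWalkFrom_law (h : ∀ k, (M k).IsRandomWalk (M k).P0) (n : ℕ) :
    IsWalkFrom (law M n) (globalFiltration K) (u M) n
      (sumLaw fun k => (M k).P0.map ((M k).u 1)) :=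
  isWalkFrom_of_sensors M (fun k _ ht => (M k).indep_step (h k) ht)
    fun k _ ht => (M k).map_step (h k) ht

theorem isWalkFrom_law_top (h : ∀ k, (M k).IsRandomWalk (M k).Pinf) :
    IsWalkFrom (law M ⊤) (globalFiltration K) (u M) 0
      (sumLaw fun k => (M k).Pinf.map ((M k).u 1)) :=
  isWalkFrom_of_sensors M (fun k t _ => (h k t).1) fun k t _ => (h k t).2.map_eq

/-- On `ℱ_t`, the law with a change at time `0` has density `exp u_t` with respect to the law without
change. -/
theorem law_zero_apply {t : ℕ} {A : Set (Path K)} (hA : MeasurableSet[globalFiltration K t] A) :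
    law M (0 : ℕ) A = ∫⁻ ω in A, ENNReal.ofReal (Real.exp (u M t ω)) ∂law M ⊤ := by
  have hmk : ∀ k, Measurable fun x => ENNReal.ofReal (Real.exp ((M k).u t x)) := fun k => by
    have := (M k).measurable_u' t
    fun_prop
  have hprob : ∀ k, IsProbabilityMeasure
      ((M k).Pinf.withDensity fun x => ENNReal.ofReal (Real.exp ((M k).u t x))) := fun k => by
    refine ⟨?_⟩
    rw [withDensity_apply _ MeasurableSet.univ, ← (M k).P0_apply MeasurableSet.univ, measure_univ]
  -- the product of the densities is the density of the product
  have hpi : (law M ⊤).withDensity (fun ω => ENNReal.ofReal (Real.exp (u M t ω))) =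
      Measure.pi fun k =>
        (M k).Pinf.withDensity fun x => ENNReal.ofReal (Real.exp ((M k).u t x)) := by
    refine (Measure.pi_eq fun s hs => ?_).symm
    have hind : iIndepFun (fun k (ω : Path K) => (s k).indicator
        (fun x => ENNReal.ofReal (Real.exp ((M k).u t x))) (ω k)) (law M ⊤) :=
      iIndepFun_pi fun k => ((hmk k).indicator (hs k)).aemeasurable
    have hprod := lintegral_prod_eq_prod_lintegral_of_indepFun Finset.univ _ hind
      fun k => ((hmk k).indicator (hs k)).comp (measurable_pi_apply k)
    rw [withDensity_apply _ (MeasurableSet.univ_pi hs),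
      ← lintegral_indicator (MeasurableSet.univ_pi hs)]
    refine Eq.trans (lintegral_congr fun ω => ?_) (hprod.trans ?_)
    · by_cases hω : ω ∈ univ.pi s
      · rw [indicator_of_mem hω, u, Real.exp_sum,
          ENNReal.ofReal_prod_of_nonneg fun k _ => (Real.exp_pos _).le]
        exact Finset.prod_congr rfl fun k _ => 
          (indicator_of_mem (hω k (mem_univ k)) fun x =>
            ENNReal.ofReal (Real.exp ((M k).u t x))).symm
      · rw [indicator_of_notMem hω]
        simp only [Set.mem_pi, mem_univ, true_implies, not_forall] at hω
        obtain ⟨k, hk⟩ := hω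
        exact (Finset.prod_eq_zero (Finset.mem_univ k) (indicator_of_notMem hk _)).symm
    · refine Finset.prod_congr rfl fun k _ => ?_
      rw [withDensity_apply _ (hs k), ← lintegral_indicator (hs k)]
      exact (measurePreserving_eval (fun k => (M k).law ⊤) k).lintegral_comp
        ((hmk k).indicator (hs k))
  rw [← withDensity_apply _ ((globalFiltration K).le t _ hA), hpi, law]
  refine ext_on_measurableSpace_of_generate_finite (μ := Measure.pi fun k => (M k).law (0 : ℕ))
    MeasurableSpace.pi _ (fun B hB => ?_) ((globalFiltration K).le t)
    (@generateFrom_pi (Fin K) (fun _ => ℕ → ℝ) _ fun _ => localFiltration t).symm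
    (@isPiSystem_pi (Fin K) (fun _ => ℕ → ℝ) fun _ => localFiltration t) (by simp) hA
  obtain ⟨s, hs, rfl⟩ := hB
  rw [Measure.pi_pi, Measure.pi_pi]
  refine Finset.prod_congr rfl fun k _ => ?_
  have hsk : MeasurableSet[localFiltration t] (s k) := hs k (mem_univ k)
  rw [(M k).law_zero, (M k).P0_apply hsk, withDensity_apply _ (localFiltration.le t _ hsk)]

end Network

/-! ### The CUSUM time -/

section Cusum

variable {K : ℕ} (M : Fin K → Sensor)

theorem le_y_iff (ν : ℝ) {t : ℕ} (ht : 1 ≤ t) (ω : Path K) :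
    ν ≤ y M t ω ↔ ∃ s < t, ν ≤ u M t ω - u M s ω := by
  have : Nonempty (Fin t) := ⟨⟨0, ht⟩⟩
  have hbdd : BddBelow (range fun s : Fin t => u M s ω) := (finite_range _).bddBelow
  unfold y
  constructor
  · intro h
    obtain ⟨s, hs⟩ := exists_eq_ciInf_of_finite (f := fun s : Fin t => u M s ω)
    exact ⟨s, s.2, by rw [hs]; exact h⟩
  · rintro ⟨s, hs, h⟩
    have := ciInf_le hbdd ⟨s, hs⟩
    simp only at this
    linarith

/-- The CUSUM time exceeds `n` exactly on the event `noAlarm`. -/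
theorem lt_cusum_iff (ν : ℝ) (n : ℕ) (ω : Path K) :
    (n : WithTop ℕ) < cusum M ν ω ↔ ω ∈ noAlarm (u M) ν n := by
  constructor
  · intro h t ht s hs
    by_contra hlt
    have h1 : 1 ≤ t := by omega
    have htn : (t : WithTop ℕ) < cusum M ν ω := lt_of_le_of_lt (by exact_mod_cast ht) h
    exact notMem_of_lt_hittingAfter htn h1 ((le_y_iff M ν h1 ω).2 ⟨s, hs, not_lt.1 hlt⟩)
  · intro h
    by_contra hle
    have hle := not_lt.1 hle
    have htop : cusum M ν ω ≠ ⊤ := fun h' => by rw [h'] at hle; exact absurd hle (by simp)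
    have hmem := hittingAfter_mem_set_of_ne_top htop
    have h1 : ((1 : ℕ) : WithTop ℕ) ≤ cusum M ν ω := le_hittingAfter (u := y M) (s := Ici ν) ω
    change y M (cusum M ν ω).untopA ω ∈ Ici ν at hmem
    lift cusum M ν ω to ℕ using htop with m hm
    change y M m ω ∈ Ici ν at hmem
    have hm1 : 1 ≤ m := WithTop.coe_le_coe.1 h1
    have hmn : m ≤ n := WithTop.coe_le_coe.1 hle
    obtain ⟨s, hs, hν⟩ := (le_y_iff M ν hm1 ω).1 hmem
    exact absurd (h m hmn s hs) (not_lt.2 hν)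

theorem klDelay_cusum_zero (ν : ℝ) :
    klDelay M (cusum M ν) 0 = stoppedValue (u M) (cusum M ν) := by
  funext ω
  have h : ((0 : ℕ) : WithTop ℕ) < cusum M ν ω := by
    rw [lt_cusum_iff, noAlarm_zero]
    exact mem_univ ω
  rw [klDelay, indicator_of_mem (show ω ∈ {ω | ((0 : ℕ) : WithTop ℕ) < cusum M ν ω} from h),
    u_zero, sub_zero]

/-- The delay of the CUSUM time as the sum of the steps taken before the alarm. -/
theorem klDelay_cusum_eq_tsum (ν : ℝ) (τ : ℕ) {ω : Path K} (h : cusum M ν ω ≠ ⊤) :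
    klDelay M (cusum M ν) τ ω = ∑' i, (noAlarm (u M) ν (τ + i)).indicator
      (fun ω => u M (τ + i + 1) ω - u M (τ + i) ω) ω := by
  have hiff := fun n => lt_cusum_iff M ν n ω
  have hval : klDelay M (cusum M ν) τ ω = if (τ : WithTop ℕ) < cusum M ν ω then
      u M (cusum M ν ω).untopA ω - u M τ ω else 0 := by
    classical
    rw [klDelay, indicator_apply]
    rfl
  rw [hval]
  lift cusum M ν ω to ℕ using h with m hm
  change (if (τ : WithTop ℕ) < m then u M m ω - u M τ ω else 0) = _
  rw [tsum_eq_sum (s := Finset.range (m - τ))]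
  · rw [Finset.sum_congr rfl (g := fun i => u M (τ + (i + 1)) ω - u M (τ + i) ω),
      Finset.sum_range_sub fun i => u M (τ + i) ω]
    · split_ifs with hτ
      · have hτ' : τ < m := by exact_mod_cast hτ
        rw [Nat.add_sub_cancel' hτ'.le, add_zero]
      · have hτ' : ¬ τ < m := fun h => hτ (by exact_mod_cast h)
        rw [Nat.sub_eq_zero_of_le (not_lt.1 hτ'), sub_self]
    · intro i hi
      have hi' : τ + i < m := by have := Finset.mem_range.1 hi; omega
      rw [indicator_of_mem ((hiff (τ + i)).1 (WithTop.coe_lt_coe.2 hi'))]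
      rfl
  · intro i hi
    rw [Finset.mem_range] at hi
    refine indicator_of_notMem (fun hmem => ?_) _
    have : τ + i < m := WithTop.coe_lt_coe.1 ((hiff (τ + i)).2 hmem)
    omega

theorem ae_cusum_ne_top {ν : ℝ} {P : Measure (Path K)} {τ : ℕ}
    (h : ∑' i, P (noAlarm (u M) ν (τ + i)) ≠ ∞) : ∀ᵐ ω ∂P, cusum M ν ω ≠ ⊤ := by
  have h0 := ENNReal.tendsto_atTop_zero_of_tsum_ne_top h
  refine le_antisymm (ge_of_tendsto' h0 fun i => measure_mono fun ω hω => ?_) zero_le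
  have hω' : cusum M ν ω = ⊤ := by simpa using hω
  rw [← lt_cusum_iff, hω']
  exact WithTop.coe_lt_top _

/-- Wald's identity for the delay of the CUSUM time. -/
theorem klDelay_wald {P : Measure (Path K)} [IsProbabilityMeasure P] {τ : ℕ} {μ : Measure ℝ}
    (hP : IsWalkFrom P (globalFiltration K) (u M) τ μ) (hμ : Integrable id μ) {ν : ℝ}
    (h : ∑' i, P (noAlarm (u M) ν (τ + i)) ≠ ∞) :
    Integrable (klDelay M (cusum M ν) τ) P ∧ ∀ A, MeasurableSet[globalFiltration K τ] A →
      ∫ ω in A, klDelay M (cusum M ν) τ ω ∂P =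
        (∫ x, x ∂μ) * (∑' i, P (A ∩ noAlarm (u M) ν (τ + i))).toReal :=
  hP.wald hμ (fun i => hP.measurableSet_noAlarm ν (τ + i)) h
    ((ae_cusum_ne_top M h).mono fun _ hω => klDelay_cusum_eq_tsum M ν τ hω)

/-- Whatever happened up to time `τ`, the CUSUM procedure started afresh at `τ` gives no earlier
alarm. -/
theorem noAlarm_add_subset {Ω : Type*} (v : ℕ → Ω → ℝ) (ν : ℝ) (τ i : ℕ) :
    noAlarm v ν (τ + i) ⊆ pathFrom v τ ⁻¹' noAlarm (fun t (w : ℕ → ℝ) => w t) ν i := by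
  intro ω hω t ht s hs
  simpa [pathFrom] using hω (τ + t) (by omega) (τ + s) (by omega)

theorem measurableSet_noAlarm_path (ν : ℝ) (n : ℕ) :
    MeasurableSet (noAlarm (fun t (w : ℕ → ℝ) => w t) ν n) := by
  unfold noAlarm; measurability

/-- Given the past up to the change at `τ`, the time to the alarm is stochastically no longer than
it is for a change at time `0`. -/
theorem measure_inter_noAlarm_le {Ω : Type*} {mΩ : MeasurableSpace Ω} {P Q : Measure Ω}
    [IsProbabilityMeasure P] [IsProbabilityMeasure Q] {F : Filtration ℕ mΩ} {v : ℕ → Ω → ℝ} {τ : ℕ}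
    {μ : Measure ℝ} (hP : IsWalkFrom P F v τ μ) (hQ : IsWalkFrom Q F v 0 μ) (ν : ℝ) {A : Set Ω}
    (hA : MeasurableSet[F τ] A) (i : ℕ) :
    P (A ∩ noAlarm v ν (τ + i)) ≤ P A * Q (noAlarm v ν i) := by
  have hQi : Q (noAlarm v ν i) = walkLaw μ (noAlarm (fun t (w : ℕ → ℝ) => w t) ν i) := by
    rw [← hQ.map_path, Measure.map_apply (measurable_pi_lambda _ hQ.measurable)
      (measurableSet_noAlarm_path ν i)]
    rfl
  rw [hQi, ← hP.measure_inter_pathFrom hA (measurableSet_noAlarm_path ν i)]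
  exact measure_mono (inter_subset_inter_right _ (noAlarm_add_subset v ν τ i))

/-! ### Moments of the first step and the lower bound -/

theorem integrable_u_one {τ : WithTop ℕ} (h : ∀ k, Integrable ((M k).u 1) ((M k).law τ)) :
    Integrable (u M 1) (law M τ) ∧
      ∫ ω, u M 1 ω ∂law M τ = ∑ k, ∫ x, (M k).u 1 x ∂(M k).law τ := by
  have hk : ∀ k, Integrable (fun ω : Path K => (M k).u 1 (ω k)) (law M τ) := fun k =>
    integrable_comp_eval (μ := fun k => (M k).law τ) (h k)
  refine ⟨integrable_finsetSum _ fun k _ => hk k, ?_⟩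
  unfold u
  rw [integral_finsetSum _ fun k _ => hk k]
  exact Finset.sum_congr rfl fun k _ =>
    integral_comp_eval (μ := fun k => (M k).law τ) (h k).aestronglyMeasurable

theorem integrable_u_one_sq {τ : WithTop ℕ}
    (h : ∀ k, Integrable (fun x => (M k).u 1 x ^ 2) ((M k).law τ)) :
    Integrable (fun ω => u M 1 ω ^ 2) (law M τ) ∧
      ∫ ω, u M 1 ω ^ 2 ∂law M τ ≤ K * ∑ k, ∫ x, (M k).u 1 x ^ 2 ∂(M k).law τ := by
  have hk : ∀ k, Integrable (fun ω : Path K => (M k).u 1 (ω k) ^ 2) (law M τ) := fun k =>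
    integrable_comp_eval (μ := fun k => (M k).law τ) (f := fun x => (M k).u 1 x ^ 2) (h k)
  have hle : ∀ ω, u M 1 ω ^ 2 ≤ K * ∑ k, (M k).u 1 (ω k) ^ 2 := fun ω => by
    simpa [u] using sq_sum_le_card_mul_sum_sq (s := Finset.univ) (f := fun k => (M k).u 1 (ω k))
  have hint : Integrable (fun ω : Path K => (K : ℝ) * ∑ k, (M k).u 1 (ω k) ^ 2) (law M τ) :=
    (integrable_finsetSum _ fun k _ => hk k).const_mul _
  have hm : Measurable (u M 1) := (measurable_u M 1).mono ((globalFiltration K).le 1) le_rfl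
  have hsq : Integrable (fun ω => u M 1 ω ^ 2) (law M τ) :=
    hint.mono' (hm.pow_const 2).aestronglyMeasurable (ae_of_all _ fun ω => by
      rw [Real.norm_of_nonneg (sq_nonneg _)]; exact hle ω)
  refine ⟨hsq, (integral_mono hsq hint hle).trans (le_of_eq ?_)⟩
  rw [integral_const_mul, integral_finsetSum _ fun k _ => hk k]
  congr 1
  exact Finset.sum_congr rfl fun k _ =>
    integral_comp_eval (μ := fun k => (M k).law τ) (f := fun x => (M k).u 1 x ^ 2)
      (h k).aestronglyMeasurable

theorem IsWalkFrom.integrable_id {Ω : Type*} {mΩ : MeasurableSpace Ω} {P : Measure Ω}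
    {F : Filtration ℕ mΩ} {v : ℕ → Ω → ℝ} {μ : Measure ℝ} (h : IsWalkFrom P F v 0 μ)
    (hv : Integrable (v 1) P) : Integrable id μ ∧ ∫ x, x ∂μ = ∫ ω, v 1 ω ∂P := by
  have hmap : P.map (v 1) = μ := by
    rw [← h.map_step 0 le_rfl]
    simp [h.zero]
  rw [← hmap]
  exact ⟨(integrable_map_measure measurable_id.aestronglyMeasurable (h.measurable 1).aemeasurable).2
    hv, integral_map (h.measurable 1).aemeasurable measurable_id.aestronglyMeasurable⟩

theorem condExp_le_const {Ω : Type*} {m m0 : MeasurableSpace Ω} (hm : m ≤ m0) {P : Measure Ω}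
    [IsProbabilityMeasure P] {f : Ω → ℝ} (hf : Integrable f P) {e : ℝ}
    (h : ∀ A, MeasurableSet[m] A → ∫ ω in A, f ω ∂P ≤ P.real A * e) : P[f|m] ≤ᵐ[P] fun _ => e := by
  have htrim : P[f|m] ≤ᵐ[P.trim hm] fun _ => e := by
    refine ae_le_of_forall_setIntegral_le (integrable_condExp.trim hm stronglyMeasurable_condExp)
      (integrable_const e) fun A hA _ => ?_
    rw [← setIntegral_trim hm stronglyMeasurable_condExp hA, setIntegral_condExp hm hf hA,
      setIntegral_const, smul_eq_mul, measureReal_def, trim_measurableSet_eq hm hA]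
    exact h A hA
  exact ae_le_of_ae_le_trim htrim

/-- The properties of the CUSUM time and the lower bound, with an explicit constant and with
sums over the sensors in place of averages. -/
theorem cusum_lower_bound (c V W : ℝ) (hc : 0 < c) (hV : 0 < V) (hW : 0 < W) (hK : 1 ≤ K)
    (hM : ∀ k, (M k).Admissible)
    (hsq : ∀ k, Integrable (fun x => (M k).u 1 x ^ 2) (M k).P0)
    (hcI : c * K ≤ ∑ k, (M k).I0)
    (hVI : ∑ k, ∫ x, (M k).u 1 x ^ 2 ∂(M k).P0 ≤ V * K)
    (hWI : ∑ k, (M k).Iinf ≤ W * K) (γ : ℝ) (hγ : 0 < γ) (ν : ℝ)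
    (hfa : ∫ ω, -stoppedValue (u M) (cusum M ν) ω ∂law M ⊤ = γ) :
    (∀ τ : WithTop ℕ, ∀ᵐ ω ∂law M τ, cusum M ν ω ≠ ⊤) ∧
    (∀ τ : ℕ, Integrable (klDelay M (cusum M ν) τ) (law M τ)) ∧
    Integrable (stoppedValue (u M) (cusum M ν)) (law M (0 : ℕ)) ∧
    J M (cusum M ν) = ((∫ ω, stoppedValue (u M) (cusum M ν) ω ∂law M (0 : ℕ) : ℝ) : EReal) ∧
    ∫ ω, stoppedValue (u M) (cusum M ν) ω ∂law M (0 : ℕ) ≥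
      Real.log γ - (W + 3 * affinityBound c V) * K := by
  have hK1 : (1 : ℝ) ≤ K := by exact_mod_cast hK
  set C := affinityBound c V
  have hC : 0 < C := affinityBound_pos hc hV
  have hQτ := isWalkFrom_law M fun k => (hM k).walk0
  have hQ := hQτ 0
  have hP := isWalkFrom_law_top M fun k => (hM k).walkInf
  have hac : ∀ n A, MeasurableSet[globalFiltration K n] A →
      law M (0 : ℕ) A = ∫⁻ ω in A, ENNReal.ofReal (Real.exp (u M n ω)) ∂law M ⊤ :=
    fun n A hA => law_zero_apply M hA
  obtain ⟨hi0, hI0⟩ := integrable_u_one M (τ := (0 : ℕ)) fun k => by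
    rw [(M k).law_zero]; exact (hM k).int0
  obtain ⟨hiinf, hIinf⟩ := integrable_u_one M (τ := ⊤) fun k => (hM k).intInf
  obtain ⟨hs0, hS0⟩ := integrable_u_one_sq M (τ := (0 : ℕ)) fun k => by
    rw [(M k).law_zero]; exact hsq k
  simp_rw [Sensor.law_zero] at hI0 hS0
  obtain ⟨hμ0, hμ0m⟩ := hQ.integrable_id hi0
  obtain ⟨hμi, hμim⟩ := hP.integrable_id hiinf
  have hIinf' : ∫ ω, u M 1 ω ∂law M ⊤ = -∑ k, (M k).Iinf := by
    rw [hIinf, ← Finset.sum_neg_distrib]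
    exact Finset.sum_congr rfl fun k _ => (neg_neg _).symm
  have hρ : (1 - ∫⁻ ω, ENNReal.ofReal (Real.exp (-u M 1 ω / 2)) ∂law M (0 : ℕ))⁻¹ ≤
      ENNReal.ofReal C := by
    refine inv_one_sub_affinity_le (hQ.measurable 1) hi0 hs0 ?_ hc hV hK1 (hI0 ▸ hcI) ?_
    · have := measure_eq_setLIntegral_exp_neg hQ.adapted hac (n := 1) MeasurableSet.univ
      rw [setLIntegral_univ, measure_univ] at this
      exact this.ge
    · refine hS0.trans ?_
      calc (K : ℝ) * ∑ k, ∫ x, (M k).u 1 x ^ 2 ∂(M k).P0 ≤ K * (V * K) := by gcongr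
        _ = V * (K : ℝ) ^ 2 := by ring
  have hfin0 : ∑' i, law M (0 : ℕ) (noAlarm (u M) ν i) ≠ ∞ := tsum_noAlarm_ne_top hQ hρ ν
  have hcmp : ∀ (τ : ℕ) A, MeasurableSet[globalFiltration K τ] A →
      ∑' i, law M τ (A ∩ noAlarm (u M) ν (τ + i)) ≤
        law M τ A * ∑' i, law M (0 : ℕ) (noAlarm (u M) ν i) := fun τ A hA => by
    rw [← ENNReal.tsum_mul_left]
    exact ENNReal.tsum_le_tsum fun i => measure_inter_noAlarm_le (hQτ τ) hQ ν hA i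
  have hfin : ∀ τ : ℕ, ∑' i, law M τ (noAlarm (u M) ν (τ + i)) ≠ ∞ := fun τ => by
    have := hcmp τ univ MeasurableSet.univ
    simp only [univ_inter, measure_univ, one_mul] at this
    exact ne_top_of_le_ne_top hfin0 this
  have hwald := fun τ => klDelay_wald M (hQτ τ) hμ0 (hfin τ)
  have hint0 := (hwald 0).1
  rw [klDelay_cusum_zero] at hint0
  set e := ∫ ω, stoppedValue (u M) (cusum M ν) ω ∂law M (0 : ℕ) with he
  have hμ0nn : 0 ≤ ∫ x, x ∂sumLaw fun k => (M k).P0.map ((M k).u 1) := by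
    rw [hμ0m, hI0]
    exact le_trans (by positivity) hcI
  have he' : e = (∫ x, x ∂sumLaw fun k => (M k).P0.map ((M k).u 1)) *
      (∑' i, law M (0 : ℕ) (noAlarm (u M) ν i)).toReal := by
    have := (hwald 0).2 univ MeasurableSet.univ
    simp only [Measure.restrict_univ, klDelay_cusum_zero, univ_inter, zero_add] at this
    exact this
  have hbound := tsum_noAlarm_le_exp hP hQ hac hC.le hρ ν hint0 (by
    filter_upwards [ae_cusum_ne_top M (hfin 0)] with ω hω
    have h0 : ((0 : ℕ) : WithTop ℕ) < cusum M ν ω := by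
      rw [lt_cusum_iff, noAlarm_zero]; exact mem_univ ω
    have hiff := fun n => lt_cusum_iff M ν n ω
    simp only [stoppedValue]
    lift cusum M ν ω to ℕ using hω with m hm
    have hm0 : 0 < m := WithTop.coe_lt_coe.1 h0
    refine ⟨m - 1, (hiff _).1 (WithTop.coe_lt_coe.2 (Nat.sub_lt hm0 one_pos)), fun h => ?_, ?_⟩
    · have : m - 1 + 1 < m := WithTop.coe_lt_coe.1 ((hiff _).2 h)
      omega
    · change u M m ω = _
      exact congrArg (fun i => u M i ω) (Nat.sub_add_cancel hm0).symm)
  have hfinP : ∑' i, law M ⊤ (noAlarm (u M) ν (0 + i)) ≠ ∞ := by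
    simp only [zero_add]
    exact ne_top_of_le_ne_top ENNReal.ofReal_ne_top hbound
  refine ⟨fun τ => ?_, fun τ => (hwald τ).1, hint0, ?_, ?_⟩
  · cases τ with
    | top => exact ae_cusum_ne_top M hfinP
    | coe n => exact ae_cusum_ne_top M (hfin n)
  · refine le_antisymm (iSup_le fun τ => ?_) (le_iSup_of_le 0 ?_)
    · have hle : (law M τ)[klDelay M (cusum M ν) τ | globalFiltration K τ] ≤ᵐ[law M τ]
          fun _ => e := by
        refine condExp_le_const ((globalFiltration K).le τ) (hwald τ).1 fun A hA => ?_
        rw [(hwald τ).2 A hA, he', mul_left_comm, measureReal_def, ← ENNReal.toReal_mul]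
        refine mul_le_mul_of_nonneg_left (ENNReal.toReal_mono ?_ (hcmp τ A hA)) hμ0nn
        exact ENNReal.mul_ne_top (measure_ne_top _ _) hfin0
      refine essSup_le_of_ae_le _ (hle.mono fun ω hω => ?_)
      exact EReal.coe_le_coe_iff.2 hω
    · rw [globalFiltration_zero, condExp_bot, klDelay_cusum_zero, ← he]
      exact (essSup_const _ (IsProbabilityMeasure.ne_zero _)).ge
  · have hγ' : γ = (∑ k, (M k).Iinf) * (∑' i, law M ⊤ (noAlarm (u M) ν i)).toReal := by
      have := (klDelay_wald M hP hμi hfinP).2 univ MeasurableSet.univ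
      rw [hμim, hIinf'] at this
      simp only [Measure.restrict_univ, klDelay_cusum_zero, univ_inter, zero_add] at this
      rw [← hfa, integral_neg, this]
      ring
    have hT : (∑' i, law M ⊤ (noAlarm (u M) ν i)).toReal ≤ C ^ 2 * Real.exp (e + C) :=
      ENNReal.toReal_le_of_le_ofReal (by positivity) hbound
    have hγle : γ ≤ W * K * (C ^ 2 * Real.exp (e + C)) := by
      rw [hγ']
      exact mul_le_mul hWI hT ENNReal.toReal_nonneg (by positivity)
    have hWK : 0 < W * K := by positivity
    have hlog := Real.log_le_log hγ hγle
    rw [Real.log_mul hWK.ne' (by positivity), Real.log_mul (by positivity) (Real.exp_pos _).ne',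
      Real.log_exp, Real.log_pow] at hlog
    have h1 := Real.log_le_sub_one_of_pos hWK
    have h2 := Real.log_le_sub_one_of_pos hC
    push_cast at hlog
    nlinarith [mul_le_mul_of_nonneg_left hK1 hC.le]

end Cusum

end SeqChange

end

theorem lemma1 (c V W : ℝ) (hc : 0 < c) :
    ∃ A : ℝ, 0 < A ∧
      ∀ (K : ℕ) (_ : 1 ≤ K) (M : Fin K → SeqChange.Sensor),
        (∀ k, (M k).Admissible) →
        (∀ k, MeasureTheory.Integrable (fun x => (M k).u 1 x ^ 2) (M k).P0) →
        c ≤ (∑ k, (M k).I0) / K →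
        (∑ k, ∫ x, (M k).u 1 x ^ 2 ∂(M k).P0) / K ≤ V →
        (∑ k, (M k).Iinf) / K ≤ W →
        ∀ γ : ℝ, 0 < γ → ∀ ν : ℝ,
          ∫ ω, -MeasureTheory.stoppedValue (SeqChange.u M) (SeqChange.cusum M ν) ω
            ∂(SeqChange.law M ⊤) = γ →
          (∀ τ : WithTop ℕ, ∀ᵐ ω ∂(SeqChange.law M τ), SeqChange.cusum M ν ω ≠ ⊤) ∧
          (∀ τ : ℕ, MeasureTheory.Integrable
            (SeqChange.klDelay M (SeqChange.cusum M ν) τ) (SeqChange.law M τ)) ∧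
          MeasureTheory.Integrable
            (MeasureTheory.stoppedValue (SeqChange.u M) (SeqChange.cusum M ν))
            (SeqChange.law M (0 : ℕ)) ∧
          SeqChange.J M (SeqChange.cusum M ν) =
            ((∫ ω, MeasureTheory.stoppedValue (SeqChange.u M) (SeqChange.cusum M ν) ω
              ∂(SeqChange.law M (0 : ℕ)) : ℝ) : EReal) ∧
          ∫ ω, MeasureTheory.stoppedValue (SeqChange.u M) (SeqChange.cusum M ν) ω
            ∂(SeqChange.law M (0 : ℕ)) ≥ Real.log γ - A * K := by
  -- `V` and `W` are raised to at least `1` to make the constant positive before `M` is known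
  have hV : 0 < max V 1 := lt_max_of_lt_right one_pos
  have hW : 0 < max W 1 := lt_max_of_lt_right one_pos
  refine ⟨max W 1 + 3 * SeqChange.affinityBound c (max V 1),
    add_pos hW (mul_pos three_pos (SeqChange.affinityBound_pos hc hV)), ?_⟩
  intro K hK M hM hsq hcI hVI hWI γ hγ ν hfa
  have hK0 : (0 : ℝ) < K := by exact_mod_cast hK
  exact SeqChange.cusum_lower_bound M c (max V 1) (max W 1) hc hV hW hK hM hsq
    ((le_div_iff₀ hK0).1 hcI)
    ((div_le_iff₀ hK0).1 (hVI.trans (le_max_left _ _)))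
    ((div_le_iff₀ hK0).1 (hWI.trans (le_max_left _ _))) γ hγ ν hfa
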